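/- Let $\Gamma$ be a finitely generated group, with word length $L$ for some finite symmetric generating set not containing $1$, and suppose that $\Gamma$ has polynomial growth, i.e. $\sum_{\gamma\in\Gamma}(1+L(\gamma))^{-s}<\infty$ for some $s>0$. For a Banach space $A$ let $H^\infty(\Gamma,A)$ be the space of families $(a_\gamma)_{\gamma\in\Gamma}$ in $A$ with $\sum_\gamma \|a_\gamma\|^2L(\gamma)^s<\infty$ for all $s\ge 0$, and put $H^\infty(\Gamma)=H^\infty(\Gamma,\mathbb C)$, which (writing $a$ as $\sum_\gamma a_\gamma\gamma$) is a $*$-subalgebra of the reduced group $C^*$-algebra $C^*_r(\Gamma)\subseteq\mathcal L(\ell^2(\Gamma))$. Let $H$ be a separable complex Hilbert space, $\mathcal K(H)$ its algebra of compact operators, and $H\otimes C^*_r(\Gamma)$ the standard Hilbert $C^*_r(\Gamma)$-module, i.e. the completion of the algebraic tensor product for the inner product $(h\otimes a\mid k\otimes b)=\langle h,k\rangle a^*b$; it contains $H^\infty(\Gamma,H)$. A (right) pre-Hilbert module over a $*$-subalgebra $S$ of a $C^*$-algebra is a right $S$-module with a positive definite $S$-valued inner product that is $S$-linear in the second variable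 and Hermitian; it is a Hilbert module if it is complete for the norm $\|x\|=\|(x\mid x)\|^{1/2}$. Isomorphisms ($\cong$) of (pre-)Hilbert modules are module isomorphisms that preserve the inner products, $\oplus$ is the orthogonal direct sum, and $S^n$ carries $(x\mid y)=\sum_i x_i^*y_i$. Let $p=p^*=p^2$ be a projection in $H^\infty(\Gamma,\mathcal K(H))\subseteq\mathcal K(H)\otimes C^*_r(\Gamma)$, and let $P=p\,(H\otimes C^*_r(\Gamma))$. Then $P$ is a Hilbert $C^*_r(\Gamma)$-module that is finitely generated and projective, both as a right $C^*_r(\Gamma)$-module and in the sense that $P\oplus Q\cong C^*_r(\Gamma)^m$ for some $m\in\mathbb N$ and some Hilbert $C^*_r(\Gamma)$-module $Q$. Moreover, for each $n\in\mathbb N$, there exists a Hilbert $C^*_r(\Gamma)$-module $Q$ such that $$P\oplus Q\cong C^*_r(\Gamma)^n$$ if and only if there exists a pre-Hilbert $H^\infty(\Gamma)$-module $Q'$ such that $$\bigl(P\cap H^\infty(\Gamma,H)\bigr)\oplus Q'\cong H^\infty(\Gamma)^n.$$ -/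

import Mathlib

universe u v

set_option linter.unusedSectionVars false

open scoped ENNReal

noncomputable section

/-! ## Finitely generated groups, word length, polynomial growth -/

/-- A finite symmetric generating set of `Γ` that does not contain the identity. -/
structure GeneratingSet (Γ : Type*) [Group Γ] where
  carrier : Finset Γ
  one_notMem : (1 : Γ) ∉ carrier
  inv_mem : ∀ g ∈ carrier, g⁻¹ ∈ carrier
  closure_eq_top : Subgroup.closure (carrier : Set Γ) = ⊤

namespace GeneratingSet

variable {Γ : Type*} [Group Γ] (S : GeneratingSet Γ)

/-- The word length: the least `n` such that `γ` is a product of `n` elements of the generating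
set. -/
def length (γ : Γ) : ℕ :=
  sInf {n : ℕ | ∃ l : List Γ, (∀ g ∈ l, g ∈ S.carrier) ∧ l.prod = γ ∧ l.length = n}

/-- Polynomial growth: `∑ (1 + L(γ))^{-s} < ∞` for some `s > 0`. -/
def PolynomialGrowth : Prop :=
  ∃ s : ℝ, 0 < s ∧ Summable fun γ : Γ => (1 + (S.length γ : ℝ)) ^ (-s)

/-- Rapidly decreasing families: `∑ |a γ|² L(γ)^s < ∞` for all `s ≥ 0`.  The space of all
rapidly decreasing `a : Γ → A` is `H^∞(Γ, A)` as a set of sequences. -/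
def RapidlyDecreasing {A : Type*} [NormedAddCommGroup A] (a : Γ → A) : Prop :=
  ∀ s : ℝ, 0 ≤ s → Summable fun γ : Γ => ‖a γ‖ ^ 2 * (S.length γ : ℝ) ^ s

theorem exists_word (γ : Γ) :
    ∃ l : List Γ, (∀ g ∈ l, g ∈ S.carrier) ∧ l.prod = γ ∧ l.length = S.length γ := by
  have hne : {n : ℕ | ∃ l : List Γ, (∀ g ∈ l, g ∈ S.carrier) ∧ l.prod = γ ∧
      l.length = n}.Nonempty := by
    have h : γ ∈ Subgroup.closure (S.carrier : Set Γ) := by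
      rw [S.closure_eq_top]; trivial
    suffices h' : ∃ l : List Γ, (∀ g ∈ l, g ∈ S.carrier) ∧ l.prod = γ by
      obtain ⟨l, hl, hp⟩ := h'
      exact ⟨l.length, l, hl, hp, rfl⟩
    induction h using Subgroup.closure_induction with
    | mem x hx => exact ⟨[x], by simpa using hx, by simp⟩
    | one => exact ⟨[], by simp, by simp⟩
    | mul x y _ _ hx hy =>
      obtain ⟨l, hl, rfl⟩ := hx
      obtain ⟨m, hm, rfl⟩ := hy
      refine ⟨l ++ m, fun g hg => ?_, by simp⟩
      rcases List.mem_append.1 hg with h1 | h1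
      · exact hl g h1
      · exact hm g h1
    | inv x _ hx =>
      obtain ⟨l, hl, rfl⟩ := hx
      refine ⟨(l.map fun g => g⁻¹).reverse, fun g hg => ?_, by rw [← List.prod_inv_reverse]⟩
      simp only [List.mem_reverse, List.mem_map] at hg
      obtain ⟨x, hx, rfl⟩ := hg
      exact S.inv_mem _ (hl x hx)
  exact Nat.sInf_mem hne

theorem length_le (l : List Γ) (hl : ∀ g ∈ l, g ∈ S.carrier) : S.length l.prod ≤ l.length :=
  Nat.sInf_le ⟨l, hl, rfl, rfl⟩

theorem length_mul_le (γ ρ : Γ) : S.length (γ * ρ) ≤ S.length γ + S.length ρ := by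
  obtain ⟨l, hl, hp, hn⟩ := S.exists_word γ
  obtain ⟨m, hm, hq, hk⟩ := S.exists_word ρ
  have h := S.length_le (l ++ m) (by
    intro g hg
    rcases List.mem_append.1 hg with h1 | h1
    · exact hl g h1
    · exact hm g h1)
  simpa [hp, hq, hn, hk] using h

theorem length_inv_le (γ : Γ) : S.length γ⁻¹ ≤ S.length γ := by
  obtain ⟨l, hl, hp, hn⟩ := S.exists_word γ
  have h := S.length_le ((l.map fun g => g⁻¹).reverse) (by
    intro g hg
    simp only [List.mem_reverse, List.mem_map] at hg
    obtain ⟨x, hx, rfl⟩ := hg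
    exact S.inv_mem _ (hl x hx))
  rw [← List.prod_inv_reverse, hp] at h
  simpa [hn] using h

theorem length_inv (γ : Γ) : S.length γ⁻¹ = S.length γ :=
  le_antisymm (S.length_inv_le γ) (by simpa using S.length_inv_le γ⁻¹)

/-- The weight `1 + L(γ)`. -/
def weight (γ : Γ) : ℝ := 1 + (S.length γ : ℝ)

theorem one_le_weight (γ : Γ) : 1 ≤ S.weight γ := by
  unfold weight
  have : (0 : ℝ) ≤ S.length γ := Nat.cast_nonneg _
  linarith

theorem weight_pos (γ : Γ) : 0 < S.weight γ := lt_of_lt_of_le one_pos (S.one_le_weight γ)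

theorem weight_mul_le (γ ρ : Γ) : S.weight (γ * ρ) ≤ S.weight γ * S.weight ρ := by
  have h : (S.length (γ * ρ) : ℝ) ≤ S.length γ + S.length ρ := by
    exact_mod_cast S.length_mul_le γ ρ
  have h1 : (0 : ℝ) ≤ S.length γ := Nat.cast_nonneg _
  have h2 : (0 : ℝ) ≤ S.length ρ := Nat.cast_nonneg _
  unfold weight
  nlinarith [mul_nonneg h1 h2]

variable {S}

theorem RapidlyDecreasing.summable_sq {A : Type*} [NormedAddCommGroup A] {a : Γ → A}
    (ha : S.RapidlyDecreasing a) (n : ℕ) : Summable fun γ => ‖a γ‖ ^ 2 * S.weight γ ^ n := by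
  have h0 := ha 0 le_rfl
  have hn := ha n (Nat.cast_nonneg n)
  refine Summable.of_nonneg_of_le (fun γ => ?_) (fun γ => ?_) ((h0.add hn).mul_left (2 ^ n))
  · have := S.weight_pos γ; positivity
  · rw [Real.rpow_zero, Real.rpow_natCast, mul_one]
    have hl : (0 : ℝ) ≤ S.length γ := Nat.cast_nonneg _
    have key : S.weight γ ^ n ≤ 2 ^ n * (1 + (S.length γ : ℝ) ^ n) := by
      unfold weight
      rcases le_total (S.length γ : ℝ) 1 with h | h
      · calc (1 + (S.length γ : ℝ)) ^ n ≤ 2 ^ n := by gcongr; linarith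
          _ = 2 ^ n * 1 := by ring
          _ ≤ _ := by gcongr; linarith [pow_nonneg hl n]
      · calc (1 + (S.length γ : ℝ)) ^ n ≤ (2 * S.length γ) ^ n := by gcongr; linarith
          _ = 2 ^ n * (S.length γ : ℝ) ^ n := by rw [mul_pow]
          _ ≤ _ := by gcongr; linarith
    calc ‖a γ‖ ^ 2 * S.weight γ ^ n
        ≤ ‖a γ‖ ^ 2 * (2 ^ n * (1 + (S.length γ : ℝ) ^ n)) := by gcongr
      _ = _ := by ring

theorem RapidlyDecreasing.summable (hS : S.PolynomialGrowth) {A : Type*} [NormedAddCommGroup A]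
    {a : Γ → A} (ha : S.RapidlyDecreasing a) (n : ℕ) :
    Summable fun γ => ‖a γ‖ * S.weight γ ^ n := by
  obtain ⟨s, -, hs⟩ := hS
  obtain ⟨m, hm⟩ := exists_nat_ge s
  have h2 := ha.summable_sq (2 * n + m)
  refine Summable.of_nonneg_of_le (fun γ => ?_) (fun γ => ?_) (h2.add hs)
  · have := S.weight_pos γ; positivity
  · have hw := S.weight_pos γ
    have hw1 := S.one_le_weight γ
    have h3 : (S.weight γ ^ m)⁻¹ ≤ (1 + (S.length γ : ℝ)) ^ (-s) := by
      change _ ≤ S.weight γ ^ (-s)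
      rw [Real.rpow_neg hw.le, ← Real.rpow_natCast]
      gcongr
    have h4 : ‖a γ‖ * S.weight γ ^ n ≤
        ‖a γ‖ ^ 2 * S.weight γ ^ (2 * n + m) + (S.weight γ ^ m)⁻¹ := by
      have e : ‖a γ‖ ^ 2 * S.weight γ ^ (2 * n + m) + (S.weight γ ^ m)⁻¹ =
          ((‖a γ‖ * S.weight γ ^ n) ^ 2 * (S.weight γ ^ m) ^ 2 + 1) / S.weight γ ^ m := by
        have h0 : S.weight γ ^ m ≠ 0 := (pow_pos hw m).ne'
        rw [eq_div_iff h0, add_mul, inv_mul_cancel₀ h0]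
        ring
      rw [e, le_div_iff₀ (by positivity)]
      nlinarith [sq_nonneg (‖a γ‖ * S.weight γ ^ n * S.weight γ ^ m - 1),
        mul_nonneg (mul_nonneg (norm_nonneg (a γ)) (pow_pos hw n).le) (pow_pos hw m).le]
    linarith

theorem rapidlyDecreasing_of_summable {A : Type*} [NormedAddCommGroup A] {a : Γ → A}
    (ha : ∀ n : ℕ, Summable fun γ => ‖a γ‖ * S.weight γ ^ n) : S.RapidlyDecreasing a := by
  intro s hs
  obtain ⟨n, hn⟩ := exists_nat_ge s
  have h0 := ha 0
  simp only [pow_zero, mul_one] at h0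
  refine Summable.of_nonneg_of_le (fun γ => by positivity) (fun γ => ?_)
    ((ha n).mul_left (∑' γ, ‖a γ‖))
  have h1 : ‖a γ‖ ≤ ∑' γ, ‖a γ‖ := h0.le_tsum γ fun _ _ => norm_nonneg _
  have hl : (0 : ℝ) ≤ S.length γ := Nat.cast_nonneg _
  have h2 : (S.length γ : ℝ) ^ s ≤ S.weight γ ^ n := by
    rw [← Real.rpow_natCast]
    calc (S.length γ : ℝ) ^ s ≤ S.weight γ ^ s := by
          apply Real.rpow_le_rpow hl _ hs
          unfold weight; linarith
      _ ≤ _ := Real.rpow_le_rpow_of_exponent_le (S.one_le_weight γ) hn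
  calc ‖a γ‖ ^ 2 * (S.length γ : ℝ) ^ s ≤ ‖a γ‖ ^ 2 * S.weight γ ^ n := by gcongr
    _ = ‖a γ‖ * (‖a γ‖ * S.weight γ ^ n) := by ring
    _ ≤ _ := by
      have := S.weight_pos γ
      gcongr

end GeneratingSet

/-! ## Operators on `ℓ²(Γ, E) = E ⊗ ℓ²(Γ)` -/

/-- The Hilbert space `E ⊗ ℓ²(Γ)` of square summable `E`-valued functions on `Γ`. -/
def EllTwo (Γ : Type*) (E : Type*) [NormedAddCommGroup E] : Type _ := lp (fun _ : Γ => E) 2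

instance (Γ E : Type*) [NormedAddCommGroup E] : NormedAddCommGroup (EllTwo Γ E) :=
  inferInstanceAs (NormedAddCommGroup (lp (fun _ : Γ => E) 2))

instance (Γ E : Type*) [NormedAddCommGroup E] [InnerProductSpace ℂ E] :
    InnerProductSpace ℂ (EllTwo Γ E) :=
  inferInstanceAs (InnerProductSpace ℂ (lp (fun _ : Γ => E) 2))

instance (Γ E : Type*) [NormedAddCommGroup E] [CompleteSpace E] : CompleteSpace (EllTwo Γ E) :=
  inferInstanceAs (CompleteSpace (lp (fun _ : Γ => E) 2))

instance (Γ E : Type*) [NormedAddCommGroup E] : FunLike (EllTwo Γ E) Γ E where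
  coe := fun (ξ : lp (fun _ : Γ => E) 2) x => ξ x
  coe_injective := fun _ _ h => lp.ext h

namespace EllTwo

variable {Γ : Type*} {E F : Type*} [NormedAddCommGroup E] [InnerProductSpace ℂ E]
  [NormedAddCommGroup F] [InnerProductSpace ℂ F]

@[ext]
theorem ext {ξ η : EllTwo Γ E} (h : ∀ x, ξ x = η x) : ξ = η := DFunLike.ext _ _ h

@[simp]
theorem add_apply (ξ η : EllTwo Γ E) (x : Γ) : (ξ + η) x = ξ x + η x := rfl

@[simp]
theorem smul_apply (c : ℂ) (ξ : EllTwo Γ E) (x : Γ) : (c • ξ) x = c • ξ x := rfl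

@[simp]
theorem zero_apply (x : Γ) : (0 : EllTwo Γ E) x = 0 := rfl

theorem summable (ξ : EllTwo Γ E) : Summable fun x => ‖ξ x‖ ^ 2 := by
  have h := (lp.memℓp (show lp (fun _ : Γ => E) 2 from ξ)).summable (by norm_num)
  simp only [ENNReal.toReal_ofNat, Real.rpow_ofNat] at h
  exact h

theorem norm_sq (ξ : EllTwo Γ E) : ‖ξ‖ ^ 2 = ∑' x, ‖ξ x‖ ^ 2 := by
  have h := lp.norm_rpow_eq_tsum (by norm_num) (show lp (fun _ : Γ => E) 2 from ξ)
  simp only [ENNReal.toReal_ofNat, Real.rpow_ofNat] at h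
  exact h

/-- A square summable function as an element of `ℓ²`. -/
def mk (f : Γ → E) (h : Summable fun x => ‖f x‖ ^ 2) : EllTwo Γ E :=
  (⟨f, memℓp_gen (by simpa using h)⟩ : lp (fun _ : Γ => E) 2)

@[simp]
theorem mk_apply (f : Γ → E) (h : Summable fun x => ‖f x‖ ^ 2) (x : Γ) : mk f h x = f x := rfl

theorem norm_le {ξ : EllTwo Γ E} {C : ℝ} (hC : 0 ≤ C) (h : ∑' x, ‖ξ x‖ ^ 2 ≤ C ^ 2) :
    ‖ξ‖ ≤ C := by
  rw [← norm_sq] at h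
  exact (sq_le_sq₀ (norm_nonneg ξ) hC).1 h

theorem inner_eq_tsum (ξ η : EllTwo Γ E) : inner ℂ ξ η = ∑' x, inner ℂ (ξ x) (η x) := rfl

theorem summable_comp (k : E →L[ℂ] F) (ξ : EllTwo Γ E) : Summable fun x => ‖k (ξ x)‖ ^ 2 := by
  refine Summable.of_nonneg_of_le (fun x => by positivity) (fun x => ?_)
    (ξ.summable.mul_left (‖k‖ ^ 2))
  rw [← mul_pow]
  gcongr
  exact k.le_opNorm _

end EllTwo

section Operators

variable {Γ : Type*} [Group Γ]
variable {E F G : Type*} [NormedAddCommGroup E] [InnerProductSpace ℂ E]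
  [NormedAddCommGroup F] [InnerProductSpace ℂ F] [NormedAddCommGroup G] [InnerProductSpace ℂ G]

/-- `k ⊗ 1 : E ⊗ ℓ²(Γ) → F ⊗ ℓ²(Γ)`, the pointwise application of `k : E → F`. -/
def ampl (Γ : Type*) {E F : Type*} [NormedAddCommGroup E] [InnerProductSpace ℂ E]
    [NormedAddCommGroup F] [InnerProductSpace ℂ F] (k : E →L[ℂ] F) :
    EllTwo Γ E →L[ℂ] EllTwo Γ F :=
  LinearMap.mkContinuous
    { toFun := fun ξ => EllTwo.mk (fun x => k (ξ x)) (EllTwo.summable_comp k ξ)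
      map_add' := fun ξ η => by ext x; simp
      map_smul' := fun c ξ => by ext x; simp }
    ‖k‖
    (fun ξ => by
      refine EllTwo.norm_le (by positivity) ?_
      rw [mul_pow, EllTwo.norm_sq, ← tsum_mul_left]
      refine Summable.tsum_le_tsum (fun x => ?_) (EllTwo.summable_comp k ξ)
        (ξ.summable.mul_left _)
      rw [← mul_pow]
      exact pow_le_pow_left₀ (norm_nonneg _) (k.le_opNorm _) 2)

@[simp]
theorem ampl_apply (k : E →L[ℂ] F) (ξ : EllTwo Γ E) (x : Γ) : ampl Γ k ξ x = k (ξ x) := rfl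

theorem norm_ampl_le (k : E →L[ℂ] F) : ‖ampl Γ k‖ ≤ ‖k‖ :=
  LinearMap.mkContinuous_norm_le _ (norm_nonneg _) _

theorem EllTwo.summable_shift (γ : Γ) (ξ : EllTwo Γ E) :
    Summable fun x => ‖ξ (γ⁻¹ * x)‖ ^ 2 :=
  ((Equiv.mulLeft γ⁻¹).summable_iff (f := fun x => ‖ξ x‖ ^ 2)).2 ξ.summable

/-- `1 ⊗ λ(γ)` on `E ⊗ ℓ²(Γ)`, with `λ` the left regular representation:
`(λ(γ) ξ)(x) = ξ(γ⁻¹ x)`. -/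
def shift (E : Type*) [NormedAddCommGroup E] [InnerProductSpace ℂ E] (γ : Γ) :
    EllTwo Γ E →L[ℂ] EllTwo Γ E :=
  LinearMap.mkContinuous
    { toFun := fun ξ => EllTwo.mk (fun x => ξ (γ⁻¹ * x))
        (EllTwo.summable_shift γ ξ)
      map_add' := fun ξ η => by ext x; simp
      map_smul' := fun c ξ => by ext x; simp }
    1
    (fun ξ => by
      refine EllTwo.norm_le (by positivity) ?_
      rw [one_mul, EllTwo.norm_sq]
      exact ((Equiv.mulLeft γ⁻¹).tsum_eq fun x => ‖ξ x‖ ^ 2).le)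

@[simp]
theorem shift_apply (γ : Γ) (ξ : EllTwo Γ E) (x : Γ) : shift E γ ξ x = ξ (γ⁻¹ * x) := rfl

theorem norm_shift_le (γ : Γ) : ‖shift (Γ := Γ) E γ‖ ≤ 1 :=
  LinearMap.mkContinuous_norm_le _ zero_le_one _

theorem shift_one : shift (Γ := Γ) E 1 = ContinuousLinearMap.id ℂ (EllTwo Γ E) := by
  ext ξ x; simp

/-- The elementary operator `k ⊗ λ(γ)`. -/
def opAt (k : E →L[ℂ] F) (γ : Γ) : EllTwo Γ E →L[ℂ] EllTwo Γ F := ampl Γ k ∘L shift E γ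

theorem opAt_apply (k : E →L[ℂ] F) (γ : Γ) (ξ : EllTwo Γ E) (x : Γ) :
    opAt k γ ξ x = k (ξ (γ⁻¹ * x)) := rfl

theorem norm_opAt_le (k : E →L[ℂ] F) (γ : Γ) : ‖opAt k γ‖ ≤ ‖k‖ := by
  have h1 : ‖opAt k γ‖ ≤ ‖ampl Γ k‖ * ‖shift (Γ := Γ) E γ‖ :=
    ContinuousLinearMap.opNorm_comp_le _ _
  have h2 : ‖ampl Γ k‖ ≤ ‖k‖ := norm_ampl_le k
  have h3 : ‖shift (Γ := Γ) E γ‖ ≤ 1 := norm_shift_le γ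
  have h4 : 0 ≤ ‖ampl Γ k‖ := norm_nonneg (ampl Γ k)
  nlinarith

theorem opAt_comp (k : F →L[ℂ] G) (l : E →L[ℂ] F) (γ ρ : Γ) :
    opAt k γ ∘L opAt l ρ = opAt (k ∘L l) (γ * ρ) := by
  ext ξ x
  simp [opAt_apply, mul_assoc]

theorem opAt_add (k l : E →L[ℂ] F) (γ : Γ) : opAt (k + l) γ = opAt k γ + opAt l γ := by
  ext ξ x
  simp [opAt_apply]

theorem opAt_smul (c : ℂ) (k : E →L[ℂ] F) (γ : Γ) : opAt (c • k) γ = c • opAt k γ := by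
  ext ξ x
  simp [opAt_apply]

/-- `k ↦ k ⊗ λ(γ)` as a continuous linear map. -/
def opAtL (E F : Type*) [NormedAddCommGroup E] [InnerProductSpace ℂ E]
    [NormedAddCommGroup F] [InnerProductSpace ℂ F] (γ : Γ) :
    (E →L[ℂ] F) →L[ℂ] (EllTwo Γ E →L[ℂ] EllTwo Γ F) :=
  LinearMap.mkContinuous
    { toFun := fun k => opAt k γ
      map_add' := fun k l => opAt_add k l γ
      map_smul' := fun c k => opAt_smul c k γ }
    1 (fun k => by simpa using norm_opAt_le k γ)

theorem opAtL_apply (γ : Γ) (k : E →L[ℂ] F) : opAtL E F γ k = opAt k γ := rfl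

theorem adjoint_opAt [CompleteSpace E] [CompleteSpace F] (k : E →L[ℂ] F) (γ : Γ) :
    ContinuousLinearMap.adjoint (opAt k γ) = opAt (ContinuousLinearMap.adjoint k) γ⁻¹ := by
  symm
  rw [ContinuousLinearMap.eq_adjoint_iff]
  intro ξ η
  rw [EllTwo.inner_eq_tsum, EllTwo.inner_eq_tsum]
  simp only [opAt_apply, ContinuousLinearMap.adjoint_inner_left, inv_inv]
  rw [← (Equiv.mulLeft γ).tsum_eq (fun x => inner ℂ (ξ x) (k (η (γ⁻¹ * x))))]
  simp

/-- The operators `∑ k(γ) ⊗ λ(γ)` with rapidly decreasing coefficients `k(γ) : E → F`. -/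
def IsRapid (S : GeneratingSet Γ) (T : EllTwo Γ E →L[ℂ] EllTwo Γ F) : Prop :=
  ∃ k : Γ → (E →L[ℂ] F), S.RapidlyDecreasing k ∧ HasSum (fun γ => opAt (k γ) γ) T

variable {S : GeneratingSet Γ}

theorem IsRapid.zero : IsRapid S (0 : EllTwo Γ E →L[ℂ] EllTwo Γ F) := by
  refine ⟨0, fun s _ => by simp, ?_⟩
  have : (fun γ => opAt ((0 : Γ → (E →L[ℂ] F)) γ) γ) = fun _ => 0 := by
    funext γ
    exact map_zero (opAtL E F γ)
  rw [this]
  exact hasSum_zero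

theorem IsRapid.smul (hS : S.PolynomialGrowth) (c : ℂ) {T : EllTwo Γ E →L[ℂ] EllTwo Γ F}
    (hT : IsRapid S T) : IsRapid S (c • T) := by
  obtain ⟨k, hk, hkT⟩ := hT
  refine ⟨fun γ => c • k γ, GeneratingSet.rapidlyDecreasing_of_summable fun n => ?_, ?_⟩
  · simpa [norm_smul, mul_assoc] using (hk.summable hS n).mul_left ‖c‖
  · simpa [opAt_smul] using hkT.const_smul c

theorem IsRapid.add (hS : S.PolynomialGrowth) {T U : EllTwo Γ E →L[ℂ] EllTwo Γ F}
    (hT : IsRapid S T) (hU : IsRapid S U) : IsRapid S (T + U) := by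
  obtain ⟨k, hk, hkT⟩ := hT
  obtain ⟨l, hl, hlU⟩ := hU
  refine ⟨fun γ => k γ + l γ, GeneratingSet.rapidlyDecreasing_of_summable fun n => ?_, ?_⟩
  · refine Summable.of_nonneg_of_le (fun γ => ?_) (fun γ => ?_)
      ((hk.summable hS n).add (hl.summable hS n))
    · have := S.weight_pos γ; positivity
    · rw [← add_mul]
      have := S.weight_pos γ
      gcongr
      exact norm_add_le _ _
  · simpa [opAt_add] using hkT.add hlU

theorem IsRapid.adjoint [CompleteSpace E] [CompleteSpace F]
    {T : EllTwo Γ E →L[ℂ] EllTwo Γ F} (hT : IsRapid S T) :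
    IsRapid S (ContinuousLinearMap.adjoint T) := by
  obtain ⟨k, hk, hkT⟩ := hT
  refine ⟨fun γ => ContinuousLinearMap.adjoint (k γ⁻¹), fun s hs => ?_, ?_⟩
  · have h := ((Equiv.inv Γ).summable_iff
      (f := fun γ => ‖k γ‖ ^ 2 * (S.length γ : ℝ) ^ s)).2 (hk s hs)
    refine h.congr fun γ => ?_
    simp [S.length_inv]
  · have h : HasSum (fun γ => ContinuousLinearMap.adjoint (opAt (k γ) γ))
        (ContinuousLinearMap.adjoint T) :=
      hkT.map (ContinuousLinearMap.adjoint (𝕜 := ℂ) (E := EllTwo Γ E) (F := EllTwo Γ F))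
        (LinearIsometryEquiv.continuous _)
    have h2 := ((Equiv.inv Γ).hasSum_iff
      (f := fun γ => ContinuousLinearMap.adjoint (opAt (k γ) γ))).2 h
    convert h2 using 2 with γ
    simp [adjoint_opAt]

theorem hasSum_comp_left (T : EllTwo Γ F →L[ℂ] EllTwo Γ G) {ι : Type*}
    {f : ι → (EllTwo Γ E →L[ℂ] EllTwo Γ F)} {U : EllTwo Γ E →L[ℂ] EllTwo Γ F}
    (h : HasSum f U) : HasSum (fun i => T ∘L f i) (T ∘L U) :=
  (ContinuousLinearMap.compL ℂ (EllTwo Γ E) (EllTwo Γ F) (EllTwo Γ G) T).hasSum h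

theorem hasSum_comp_right {ι : Type*}
    {f : ι → (EllTwo Γ F →L[ℂ] EllTwo Γ G)} {T : EllTwo Γ F →L[ℂ] EllTwo Γ G}
    (h : HasSum f T) (U : EllTwo Γ E →L[ℂ] EllTwo Γ F) :
    HasSum (fun i => f i ∘L U) (T ∘L U) :=
  ((ContinuousLinearMap.compL ℂ (EllTwo Γ E) (EllTwo Γ F) (EllTwo Γ G)).flip U).hasSum h

theorem hasSum_opAt {ι : Type*} {f : ι → (E →L[ℂ] F)} {k : E →L[ℂ] F} (h : HasSum f k) (γ : Γ) :
    HasSum (fun i => opAt (f i) γ) (opAt k γ) :=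
  (opAtL E F γ).hasSum h

/-- The substitution `(γ, ρ) ↦ (ρ, ρ⁻¹ γ)`. -/
def convEquiv (Γ : Type*) [Group Γ] : Γ × Γ ≃ Γ × Γ where
  toFun q := (q.2, q.2⁻¹ * q.1)
  invFun q := (q.1 * q.2, q.1)
  left_inv q := by simp
  right_inv q := by simp

theorem hasSum_prod_comp [CompleteSpace G] {k : Γ → (F →L[ℂ] G)} {l : Γ → (E →L[ℂ] F)}
    {T : EllTwo Γ F →L[ℂ] EllTwo Γ G} {U : EllTwo Γ E →L[ℂ] EllTwo Γ F}
    (hkT : HasSum (fun γ => opAt (k γ) γ) T) (hlU : HasSum (fun γ => opAt (l γ) γ) U)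
    (h0 : Summable fun q : Γ × Γ => ‖k q.1‖ * ‖l q.2‖) :
    HasSum (fun q : Γ × Γ => opAt (k q.1 ∘L l q.2) (q.1 * q.2)) (T ∘L U) := by
  have hf : Summable fun q : Γ × Γ => opAt (k q.1 ∘L l q.2) (q.1 * q.2) :=
    Summable.of_norm_bounded h0 fun q =>
      (norm_opAt_le _ _).trans (ContinuousLinearMap.opNorm_comp_le _ _)
  have h1 := hf.hasSum.prod_fiberwise (g := fun ρ => opAt (k ρ) ρ ∘L U) fun ρ => by
    have h2 := hasSum_comp_left (opAt (k ρ) ρ) hlU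
    simp only [opAt_comp] at h2
    exact h2
  rw [← h1.unique (hasSum_comp_right hkT U)]
  exact hf.hasSum

theorem IsRapid.comp (hS : S.PolynomialGrowth) [CompleteSpace E] [CompleteSpace F]
    [CompleteSpace G]
    {T : EllTwo Γ F →L[ℂ] EllTwo Γ G} {U : EllTwo Γ E →L[ℂ] EllTwo Γ F}
    (hT : IsRapid S T) (hU : IsRapid S U) : IsRapid S (T ∘L U) := by
  obtain ⟨k, hk, hkT⟩ := hT
  obtain ⟨l, hl, hlU⟩ := hU
  have hprod : ∀ n : ℕ, Summable fun q : Γ × Γ =>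
      (‖k q.1‖ * S.weight q.1 ^ n) * (‖l q.2‖ * S.weight q.2 ^ n) := fun n =>
    Summable.mul_of_nonneg (f := fun γ => ‖k γ‖ * S.weight γ ^ n)
      (g := fun γ => ‖l γ‖ * S.weight γ ^ n) (hk.summable hS n) (hl.summable hS n)
      (fun γ => mul_nonneg (norm_nonneg (k γ)) (pow_nonneg (S.weight_pos γ).le n))
      (fun γ => mul_nonneg (norm_nonneg (l γ)) (pow_nonneg (S.weight_pos γ).le n))
  have hprod' : ∀ n : ℕ, Summable fun q : Γ × Γ =>
      (‖k q.2‖ * S.weight q.2 ^ n) *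
        (‖l (q.2⁻¹ * q.1)‖ * S.weight (q.2⁻¹ * q.1) ^ n) := fun n =>
    ((convEquiv Γ).summable_iff (f := fun q : Γ × Γ =>
      (‖k q.1‖ * S.weight q.1 ^ n) * (‖l q.2‖ * S.weight q.2 ^ n))).2 (hprod n)
  have hc : ∀ γ, Summable fun ρ => ‖k ρ‖ * ‖l (ρ⁻¹ * γ)‖ := fun γ => by
    have h := (hprod' 0).prod_factor γ
    simp only [pow_zero, mul_one] at h
    exact h
  have hc' : ∀ γ, Summable fun ρ => k ρ ∘L l (ρ⁻¹ * γ) := fun γ =>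
    Summable.of_norm_bounded (hc γ) fun ρ => ContinuousLinearMap.opNorm_comp_le _ _
  have h0 := hprod 0
  simp only [pow_zero, mul_one] at h0
  have hsum : HasSum (fun q : Γ × Γ => opAt (k q.2 ∘L l (q.2⁻¹ * q.1)) q.1) (T ∘L U) := by
    have h1 := (convEquiv Γ).hasSum_iff.2 (hasSum_prod_comp hkT hlU h0)
    have h2 : (fun q : Γ × Γ => opAt (k q.1 ∘L l q.2) (q.1 * q.2)) ∘ convEquiv Γ =
        fun q : Γ × Γ => opAt (k q.2 ∘L l (q.2⁻¹ * q.1)) q.1 := by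
      funext q
      simp only [Function.comp_apply, convEquiv, Equiv.coe_fn_mk, mul_inv_cancel_left]
    rwa [h2] at h1
  refine ⟨fun γ => ∑' ρ, k ρ ∘L l (ρ⁻¹ * γ),
    GeneratingSet.rapidlyDecreasing_of_summable fun n => ?_,
    hsum.prod_fiberwise fun γ => hasSum_opAt (hc' γ).hasSum γ⟩
  refine Summable.of_nonneg_of_le (fun γ => ?_) (fun γ => ?_) (hprod' n).prod
  · have := S.weight_pos γ; positivity
  · have hn := (hprod' n).prod_factor γ
    calc ‖∑' ρ, k ρ ∘L l (ρ⁻¹ * γ)‖ * S.weight γ ^ n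
        ≤ (∑' ρ, ‖k ρ‖ * ‖l (ρ⁻¹ * γ)‖) * S.weight γ ^ n := by
          have := S.weight_pos γ
          gcongr
          exact tsum_of_norm_bounded (hc γ).hasSum
            fun ρ => ContinuousLinearMap.opNorm_comp_le _ _
      _ = ∑' ρ, ‖k ρ‖ * ‖l (ρ⁻¹ * γ)‖ * S.weight γ ^ n := tsum_mul_right.symm
      _ ≤ _ := by
          refine Summable.tsum_le_tsum (fun ρ => ?_) ((hc γ).mul_right _) hn
          have h1 : S.weight γ ≤ S.weight ρ * S.weight (ρ⁻¹ * γ) := by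
            simpa using S.weight_mul_le ρ (ρ⁻¹ * γ)
          have := S.weight_pos γ
          calc ‖k ρ‖ * ‖l (ρ⁻¹ * γ)‖ * S.weight γ ^ n
              ≤ ‖k ρ‖ * ‖l (ρ⁻¹ * γ)‖ * (S.weight ρ * S.weight (ρ⁻¹ * γ)) ^ n := by gcongr
            _ = _ := by rw [mul_pow]; ring

end Operators

/-! ## The algebras `C*_r(Γ)` and `H^∞(Γ)`, the modules `H ⊗ C*_r(Γ)` and `H^∞(Γ, H)` -/

section Algebras

variable {Γ : Type*} [Group Γ]

/-- The reduced group C⋆-algebra: the norm closure in `𝓛(ℓ²(Γ))` of the ⋆-algebra generated by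
(that is, of the span of) the left translations. -/
def reducedCStar (Γ : Type*) [Group Γ] : StarSubalgebra ℂ (EllTwo Γ ℂ →L[ℂ] EllTwo Γ ℂ) :=
  (StarAlgebra.adjoin ℂ (Set.range fun γ : Γ => shift ℂ γ)).topologicalClosure

theorem shift_mem_reducedCStar (γ : Γ) : shift ℂ γ ∈ reducedCStar Γ :=
  StarSubalgebra.le_topologicalClosure _ (StarAlgebra.subset_adjoin ℂ _ ⟨γ, rfl⟩)

theorem isClosed_reducedCStar :
    IsClosed (reducedCStar Γ : Set (EllTwo Γ ℂ →L[ℂ] EllTwo Γ ℂ)) :=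
  StarSubalgebra.isClosed_topologicalClosure _

theorem opAt_scalar (z : ℂ) (γ : Γ) :
    opAt (ContinuousLinearMap.toSpanSingleton ℂ z) γ = z • shift ℂ γ := by
  ext ξ x
  simp [opAt_apply, mul_comm]

theorem mem_Hinf_iff (S : GeneratingSet Γ) (T : EllTwo Γ ℂ →L[ℂ] EllTwo Γ ℂ) :
    (∃ a : Γ → ℂ, S.RapidlyDecreasing a ∧ HasSum (fun γ => a γ • shift ℂ γ) T) ↔
      IsRapid S T := by
  constructor
  · rintro ⟨a, ha, haT⟩
    refine ⟨fun γ => ContinuousLinearMap.toSpanSingleton ℂ (a γ), fun s hs => ?_, ?_⟩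
    · simpa using ha s hs
    · simpa [opAt_scalar] using haT
  · rintro ⟨k, hk, hkT⟩
    have e : ∀ γ, ContinuousLinearMap.toSpanSingleton ℂ (k γ 1) = k γ := fun γ => by ext; simp
    refine ⟨fun γ => k γ 1, fun s hs => (hk s hs).congr fun γ => ?_, ?_⟩
    · rw [← ContinuousLinearMap.norm_toSpanSingleton (𝕜 := ℂ) (k γ 1), e]
    · simpa [← opAt_scalar, e] using hkT

/-- `H^∞(Γ)` as a ⋆-subalgebra of `C*_r(Γ) ⊆ 𝓛(ℓ²(Γ))`: the rapidly decreasing sequence `a` is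
the operator `∑ a(γ) λ(γ)` (the series converges absolutely by polynomial growth), so that the
product is the convolution and the involution is `a^*(γ) = conj a(γ⁻¹)`. -/
def Hinf (S : GeneratingSet Γ) (hS : S.PolynomialGrowth) :
    StarSubalgebra ℂ (EllTwo Γ ℂ →L[ℂ] EllTwo Γ ℂ) where
  carrier := {T | ∃ a : Γ → ℂ, S.RapidlyDecreasing a ∧ HasSum (fun γ => a γ • shift ℂ γ) T}
  add_mem' := fun {T U} hT hU => by
    simp only [Set.mem_ofPred_eq, mem_Hinf_iff] at *
    exact hT.add hS hU
  mul_mem' := fun {T U} hT hU => by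
    simp only [Set.mem_ofPred_eq, mem_Hinf_iff] at *
    exact hT.comp hS hU
  star_mem' := fun {T} hT => by
    simp only [Set.mem_ofPred_eq, mem_Hinf_iff] at *
    exact hT.adjoint
  algebraMap_mem' := fun z => by
    classical
    refine ⟨Pi.single 1 z, fun s _ => ?_, ?_⟩
    · refine summable_of_ne_finset_zero (s := {1}) fun γ hγ => ?_
      have : γ ≠ 1 := by simpa using hγ
      simp [this]
    · have h := hasSum_single (f := fun γ : Γ => (Pi.single 1 z : Γ → ℂ) γ • shift ℂ γ) 1
        (fun γ hγ => by simp [hγ])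
      simp only [Pi.single_eq_same, shift_one] at h
      exact h

theorem Hinf_le (S : GeneratingSet Γ) (hS : S.PolynomialGrowth) :
    Hinf S hS ≤ reducedCStar Γ := by
  rintro T ⟨a, -, haT⟩
  refine isClosed_reducedCStar.mem_of_tendsto haT (Filter.Eventually.of_forall fun s => ?_)
  exact sum_mem fun γ _ => SMulMemClass.smul_mem _ (shift_mem_reducedCStar γ)

variable {H : Type*} [NormedAddCommGroup H] [InnerProductSpace ℂ H]

/-- The operator `ℓ²(Γ) → H ⊗ ℓ²(Γ)`, `ξ ↦ h ⊗ ξ`. -/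
def tensorLeft (Γ : Type*) {H : Type*} [NormedAddCommGroup H] [InnerProductSpace ℂ H] (h : H) :
    EllTwo Γ ℂ →L[ℂ] EllTwo Γ H :=
  ampl Γ (ContinuousLinearMap.toSpanSingleton ℂ h)

/-- The standard Hilbert module `H ⊗ C*_r(Γ)`.  The elementary tensor `h ⊗ a` is realized as the
operator `ξ ↦ h ⊗ a ξ` from `ℓ²(Γ)` to `H ⊗ ℓ²(Γ)`.  Since
`(h ⊗ a)^* (k ⊗ b) = ⟨h, k⟩ a^* b`, the inner product of the algebraic tensor product is
`(x | y) = x^* y`, its norm is the operator norm, and its completion is the norm closure. -/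
def stdModule (Γ H : Type*) [Group Γ] [NormedAddCommGroup H] [InnerProductSpace ℂ H] :
    Submodule ℂ (EllTwo Γ ℂ →L[ℂ] EllTwo Γ H) :=
  (Submodule.span ℂ {T | ∃ h : H, ∃ a ∈ reducedCStar Γ,
    T = tensorLeft Γ h ∘L a}).topologicalClosure

theorem mem_HinfVec_iff (S : GeneratingSet Γ) (T : EllTwo Γ ℂ →L[ℂ] EllTwo Γ H) :
    (∃ h : Γ → H, S.RapidlyDecreasing h ∧
      HasSum (fun γ => tensorLeft Γ (h γ) ∘L shift ℂ γ) T) ↔ IsRapid S T := by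
  constructor
  · rintro ⟨h, hh, hT⟩
    refine ⟨fun γ => ContinuousLinearMap.toSpanSingleton ℂ (h γ), fun s hs => ?_, hT⟩
    simpa using hh s hs
  · rintro ⟨k, hk, hkT⟩
    have e : ∀ γ, ContinuousLinearMap.toSpanSingleton ℂ (k γ 1) = k γ := fun γ => by ext; simp
    refine ⟨fun γ => k γ 1, fun s hs => (hk s hs).congr fun γ => ?_, ?_⟩
    · rw [← ContinuousLinearMap.norm_toSpanSingleton (𝕜 := ℂ) (k γ 1), e]
    · simpa [tensorLeft, e, opAt] using hkT

/-- `H^∞(Γ, H)` inside `H ⊗ C*_r(Γ)`: the rapidly decreasing sequence `h` is `∑ h(γ) ⊗ λ(γ)`. -/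
def HinfVec (S : GeneratingSet Γ) (hS : S.PolynomialGrowth) (H : Type*) [NormedAddCommGroup H]
    [InnerProductSpace ℂ H] : Submodule ℂ (EllTwo Γ ℂ →L[ℂ] EllTwo Γ H) where
  carrier := {T | ∃ h : Γ → H, S.RapidlyDecreasing h ∧
    HasSum (fun γ => tensorLeft Γ (h γ) ∘L shift ℂ γ) T}
  add_mem' := fun {T U} hT hU => by
    simp only [Set.mem_ofPred_eq, mem_HinfVec_iff] at *
    exact hT.add hS hU
  zero_mem' := by
    simp only [Set.mem_ofPred_eq, mem_HinfVec_iff]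
    exact IsRapid.zero
  smul_mem' := fun c T hT => by
    simp only [Set.mem_ofPred_eq, mem_HinfVec_iff] at *
    exact hT.smul hS c

/-- `H^∞(Γ, 𝓚(H))` inside `𝓛(H ⊗ ℓ²(Γ))`, where the spatial tensor product `𝓚(H) ⊗ C*_r(Γ)`
lives: the rapidly decreasing sequence `k` of compact operators is `∑ k(γ) ⊗ λ(γ)`. -/
def HinfCompact (S : GeneratingSet Γ) (H : Type*) [NormedAddCommGroup H]
    [InnerProductSpace ℂ H] : Set (EllTwo Γ H →L[ℂ] EllTwo Γ H) :=
  {T | ∃ k : Γ → (H →L[ℂ] H), (∀ γ, IsCompactOperator (k γ)) ∧ S.RapidlyDecreasing k ∧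
    HasSum (fun γ => ampl Γ (k γ) ∘L shift H γ) T}

theorem stdModule_induction {q : (EllTwo Γ ℂ →L[ℂ] EllTwo Γ H) → Prop}
    (V : Submodule ℂ (EllTwo Γ ℂ →L[ℂ] EllTwo Γ H))
    (hV : IsClosed (V : Set (EllTwo Γ ℂ →L[ℂ] EllTwo Γ H))) (hq : ∀ x, x ∈ V ↔ q x)
    (h0 : ∀ h : H, ∀ a ∈ reducedCStar Γ, q (tensorLeft Γ h ∘L a))
    {x : EllTwo Γ ℂ →L[ℂ] EllTwo Γ H} (hx : x ∈ stdModule Γ H) : q x := by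
  rw [← hq]
  refine Submodule.topologicalClosure_minimal _ ?_ hV hx
  rw [Submodule.span_le]
  rintro _ ⟨h, a, ha, rfl⟩
  exact (hq _).2 (h0 h a ha)

theorem isClosed_stdModule :
    IsClosed (stdModule Γ H : Set (EllTwo Γ ℂ →L[ℂ] EllTwo Γ H)) :=
  Submodule.isClosed_topologicalClosure _

theorem tensorLeft_mem_stdModule (h : H) {a : EllTwo Γ ℂ →L[ℂ] EllTwo Γ ℂ}
    (ha : a ∈ reducedCStar Γ) : tensorLeft Γ h ∘L a ∈ stdModule Γ H :=
  Submodule.le_topologicalClosure _ (Submodule.subset_span ⟨h, a, ha, rfl⟩)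

theorem stdModule_comp {x : EllTwo Γ ℂ →L[ℂ] EllTwo Γ H} (hx : x ∈ stdModule Γ H)
    {a : EllTwo Γ ℂ →L[ℂ] EllTwo Γ ℂ} (ha : a ∈ reducedCStar Γ) : x ∘L a ∈ stdModule Γ H := by
  let φ := (ContinuousLinearMap.compL ℂ (EllTwo Γ ℂ) (EllTwo Γ ℂ) (EllTwo Γ H)).flip a
  refine stdModule_induction (q := fun y => y ∘L a ∈ stdModule Γ H)
    ((stdModule Γ H).comap φ.toLinearMap)
    (isClosed_stdModule.preimage φ.continuous) (fun _ => Iff.rfl) ?_ hx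
  intro h b hb
  rw [ContinuousLinearMap.comp_assoc]
  exact tensorLeft_mem_stdModule h (mul_mem hb ha)

theorem comp_stdModule {S : GeneratingSet Γ} {p : EllTwo Γ H →L[ℂ] EllTwo Γ H}
    (hp : p ∈ HinfCompact S H) {x : EllTwo Γ ℂ →L[ℂ] EllTwo Γ H} (hx : x ∈ stdModule Γ H) :
    p ∘L x ∈ stdModule Γ H := by
  let φ := ContinuousLinearMap.compL ℂ (EllTwo Γ ℂ) (EllTwo Γ H) (EllTwo Γ H) p
  refine stdModule_induction (q := fun y => p ∘L y ∈ stdModule Γ H)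
    ((stdModule Γ H).comap φ.toLinearMap)
    (isClosed_stdModule.preimage φ.continuous) (fun _ => Iff.rfl) ?_ hx
  intro h a ha
  obtain ⟨k, -, -, hk⟩ := hp
  have h1 : HasSum (fun γ => (ampl Γ (k γ) ∘L shift H γ) ∘L (tensorLeft Γ h ∘L a))
      (p ∘L (tensorLeft Γ h ∘L a)) :=
    hasSum_comp_right hk _
  refine isClosed_stdModule.mem_of_tendsto h1 (Filter.Eventually.of_forall fun s => ?_)
  refine sum_mem fun γ _ => ?_
  have e : (ampl Γ (k γ) ∘L shift H γ) ∘L (tensorLeft Γ h ∘L a) =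
      tensorLeft Γ (k γ h) ∘L (shift ℂ γ * a) := by
    ext ξ x
    simp [tensorLeft]
  rw [e]
  exact tensorLeft_mem_stdModule _ (mul_mem (shift_mem_reducedCStar γ) ha)

variable [CompleteSpace H]

/-- The defining formula `(h ⊗ a | k ⊗ b) = ⟨h, k⟩ a^* b` of the inner product. -/
theorem adjoint_tensorLeft_comp (h k : H) (a b : EllTwo Γ ℂ →L[ℂ] EllTwo Γ ℂ) :
    ContinuousLinearMap.adjoint (tensorLeft Γ h ∘L a) ∘L (tensorLeft Γ k ∘L b) =
      inner ℂ h k • (star a * b) := by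
  have e : ContinuousLinearMap.adjoint (tensorLeft Γ h) ∘L tensorLeft Γ k =
      inner ℂ h k • ContinuousLinearMap.id ℂ (EllTwo Γ ℂ) := by
    have h1 : tensorLeft Γ h = opAt (ContinuousLinearMap.toSpanSingleton ℂ h) (1 : Γ) := by
      simp [tensorLeft, opAt, shift_one]
    have h2 : tensorLeft Γ k = opAt (ContinuousLinearMap.toSpanSingleton ℂ k) (1 : Γ) := by
      simp [tensorLeft, opAt, shift_one]
    rw [h1, h2, adjoint_opAt, opAt_comp]
    ext ξ x
    have h3 : ∀ z : ℂ, ContinuousLinearMap.adjoint (ContinuousLinearMap.toSpanSingleton ℂ h)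
        (z • k) = inner ℂ h k * z := fun z => by
      refine ext_inner_left ℂ fun w => ?_
      rw [ContinuousLinearMap.adjoint_inner_right]
      simp [inner_smul_left, inner_smul_right, mul_comm]
      ring
    simp only [opAt_apply, ContinuousLinearMap.comp_apply,
      ContinuousLinearMap.toSpanSingleton_apply, h3]
    simp
  rw [ContinuousLinearMap.adjoint_comp]
  ext ξ x
  have := DFunLike.congr_fun e (b ξ)
  simp only [ContinuousLinearMap.comp_apply] at this ⊢
  rw [this]
  simp [ContinuousLinearMap.star_eq_adjoint]

theorem adjoint_comp_mem {x y : EllTwo Γ ℂ →L[ℂ] EllTwo Γ H} (hx : x ∈ stdModule Γ H)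
    (hy : y ∈ stdModule Γ H) : ContinuousLinearMap.adjoint x ∘L y ∈ reducedCStar Γ := by
  have key : ∀ h : H, ∀ a ∈ reducedCStar Γ, ∀ z ∈ stdModule Γ H,
      ContinuousLinearMap.adjoint (tensorLeft Γ h ∘L a) ∘L z ∈ reducedCStar Γ := by
    intro h a ha z hz
    let φ := ContinuousLinearMap.compL ℂ (EllTwo Γ ℂ) (EllTwo Γ H) (EllTwo Γ ℂ)
      (ContinuousLinearMap.adjoint (tensorLeft Γ h ∘L a))
    refine stdModule_induction
      (q := fun y => ContinuousLinearMap.adjoint (tensorLeft Γ h ∘L a) ∘L y ∈ reducedCStar Γ)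
      ((Subalgebra.toSubmodule (reducedCStar Γ).toSubalgebra).comap φ.toLinearMap)
      (isClosed_reducedCStar.preimage φ.continuous) (fun _ => Iff.rfl) ?_ hz
    intro k b hb
    rw [adjoint_tensorLeft_comp]
    exact SMulMemClass.smul_mem _ (mul_mem (star_mem ha) hb)
  let φ := (ContinuousLinearMap.compL ℂ (EllTwo Γ ℂ) (EllTwo Γ H) (EllTwo Γ ℂ))
    (ContinuousLinearMap.adjoint y)
  have h2 : ContinuousLinearMap.adjoint y ∘L x ∈ reducedCStar Γ := by
    refine stdModule_induction
      (q := fun z => ContinuousLinearMap.adjoint y ∘L z ∈ reducedCStar Γ)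
      ((Subalgebra.toSubmodule (reducedCStar Γ).toSubalgebra).comap φ.toLinearMap)
      (isClosed_reducedCStar.preimage φ.continuous) (fun _ => Iff.rfl) ?_ hx
    intro k b hb
    have h3 := star_mem (key k b hb y hy)
    rwa [ContinuousLinearMap.star_eq_adjoint, ContinuousLinearMap.adjoint_comp,
      ContinuousLinearMap.adjoint_adjoint] at h3
  have h3 := star_mem h2
  rwa [ContinuousLinearMap.star_eq_adjoint, ContinuousLinearMap.adjoint_comp,
    ContinuousLinearMap.adjoint_adjoint] at h3

end Algebras

/-! ## Pre-Hilbert modules -/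

/-- A (right) pre-Hilbert module over a unital pre-C⋆-algebra `S`, that is, over a ⋆-subalgebra
`S` of a C⋆-algebra `B`.  The complex scalars act through `ℂ ⊆ S`, so that the inner product is
linear in the second argument (the case `a ∈ ℂ` of `inner_smul_right`) and antilinear in the
first. Positivity in the completion of `S` is positivity in `B`. -/
structure PreHilbertModule {B : Type*} [CStarAlgebra B] [PartialOrder B] [StarOrderedRing B]
    (S : StarSubalgebra ℂ B) where
  carrier : Type*
  [addCommGroup : AddCommGroup carrier]
  [module : Module (↥S)ᵐᵒᵖ carrier]
  inner : carrier → carrier → S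
  inner_add_right : ∀ x y z, inner x (y + z) = inner x y + inner x z
  inner_smul_right : ∀ x y (a : S), inner x (MulOpposite.op a • y) = inner x y * a
  star_inner : ∀ x y, star (inner x y) = inner y x
  inner_self_nonneg : ∀ x, 0 ≤ (inner x x : B)
  inner_self_eq_zero : ∀ x, inner x x = 0 → x = 0

namespace PreHilbertModule

attribute [instance] PreHilbertModule.addCommGroup PreHilbertModule.module

variable {B : Type*} [CStarAlgebra B] [PartialOrder B] [StarOrderedRing B]
  {S : StarSubalgebra ℂ B}

/-- The norm `‖x‖ = ‖(x | x)‖^{1/2}`. -/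
def norm (M : PreHilbertModule S) (x : M.carrier) : ℝ := Real.sqrt ‖(M.inner x x : B)‖

/-- `M` is a Hilbert module if it is complete for its norm. -/
def IsHilbert (M : PreHilbertModule S) : Prop :=
  ∀ x : ℕ → M.carrier,
    (∀ ε : ℝ, 0 < ε → ∃ N, ∀ m ≥ N, ∀ n ≥ N, M.norm (x m - x n) < ε) →
      ∃ y : M.carrier, ∀ ε : ℝ, 0 < ε → ∃ N, ∀ n ≥ N, M.norm (x n - y) < ε

/-- An isomorphism of pre-Hilbert modules is an isomorphism of right modules that preserves the
inner products. -/
def Isomorphic (M N : PreHilbertModule S) : Prop :=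
  ∃ e : M.carrier ≃ₗ[(↥S)ᵐᵒᵖ] N.carrier, ∀ x y, N.inner (e x) (e y) = M.inner x y

/-- The orthogonal direct sum `M ⊕ N`. -/
def directSum (M N : PreHilbertModule S) : PreHilbertModule S where
  carrier := M.carrier × N.carrier
  inner := fun x y => M.inner x.1 y.1 + N.inner x.2 y.2
  inner_add_right := fun x y z => by
    simp only [Prod.fst_add, Prod.snd_add, M.inner_add_right, N.inner_add_right]
    abel
  inner_smul_right := fun x y a => by
    simp only [Prod.smul_fst, Prod.smul_snd, M.inner_smul_right, N.inner_smul_right, add_mul]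
  star_inner := fun x y => by simp only [star_add, M.star_inner, N.star_inner]
  inner_self_nonneg := fun x => add_nonneg (M.inner_self_nonneg _) (N.inner_self_nonneg _)
  inner_self_eq_zero := fun x hx => by
    have h : (M.inner x.1 x.1 : B) + (N.inner x.2 x.2 : B) = 0 := congrArg Subtype.val hx
    rw [add_eq_zero_iff_of_nonneg (M.inner_self_nonneg _) (N.inner_self_nonneg _)] at h
    exact Prod.ext (M.inner_self_eq_zero _ (Subtype.ext h.1))
      (N.inner_self_eq_zero _ (Subtype.ext h.2))

/-- The free module `Sⁿ` with inner product `(x | y) = ∑ xᵢ^* yᵢ`. -/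
def free (S : StarSubalgebra ℂ B) (n : ℕ) : PreHilbertModule S where
  carrier := Fin n → S
  inner := fun x y => ∑ i, star (x i) * y i
  inner_add_right := fun x y z => by simp [mul_add, Finset.sum_add_distrib]
  inner_smul_right := fun x y a => by simp [Finset.sum_mul, mul_assoc]
  star_inner := fun x y => by simp
  inner_self_nonneg := fun x => by
    have e : ((∑ i, star (x i) * x i : S) : B) = ∑ i, star (x i : B) * (x i : B) := by simp
    rw [e]
    exact Finset.sum_nonneg fun i _ => star_mul_self_nonneg _
  inner_self_eq_zero := fun x hx => by
    have h : ∑ i, star (x i : B) * (x i : B) = 0 := by simpa using congrArg Subtype.val hx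
    rw [Finset.sum_eq_zero_iff_of_nonneg fun i _ => star_mul_self_nonneg _] at h
    funext i
    exact Subtype.ext (CStarRing.star_mul_self_eq_zero_iff _ |>.1 (h i (Finset.mem_univ i)))

/-- A space `V` of operators `K₁ → K₂` as a pre-Hilbert module over a ⋆-algebra `S` of operators
on `K₁`, with `x · a = x ∘ a` and `(x | y) = x^* y`. -/
def ofOperators {K₁ K₂ : Type*} [NormedAddCommGroup K₁] [InnerProductSpace ℂ K₁]
    [CompleteSpace K₁] [NormedAddCommGroup K₂] [InnerProductSpace ℂ K₂] [CompleteSpace K₂]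
    (S : StarSubalgebra ℂ (K₁ →L[ℂ] K₁)) (V : Submodule ℂ (K₁ →L[ℂ] K₂))
    (hV : ∀ x ∈ V, ∀ a ∈ S, x ∘L a ∈ V)
    (hS : ∀ x ∈ V, ∀ y ∈ V, ContinuousLinearMap.adjoint x ∘L y ∈ S) : PreHilbertModule S where
  carrier := V
  module :=
    { smul := fun a x => ⟨(x : K₁ →L[ℂ] K₂) ∘L (a.unop : K₁ →L[ℂ] K₁), hV _ x.2 _ a.unop.2⟩
      one_smul := fun x => Subtype.ext (ContinuousLinearMap.comp_id _)
      mul_smul := fun a b x => Subtype.ext (ContinuousLinearMap.comp_assoc _ _ _).symm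
      smul_zero := fun a => Subtype.ext (ContinuousLinearMap.zero_comp _)
      smul_add := fun a x y => Subtype.ext (ContinuousLinearMap.add_comp _ _ _)
      add_smul := fun a b x => Subtype.ext (ContinuousLinearMap.comp_add _ _ _)
      zero_smul := fun x => Subtype.ext (ContinuousLinearMap.comp_zero _) }
  inner := fun x y => ⟨ContinuousLinearMap.adjoint (x : K₁ →L[ℂ] K₂) ∘L (y : K₁ →L[ℂ] K₂),
    hS _ x.2 _ y.2⟩
  inner_add_right := fun x y z => Subtype.ext (ContinuousLinearMap.comp_add _ _ _)
  inner_smul_right := fun x y a => Subtype.ext (ContinuousLinearMap.comp_assoc _ _ _).symm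
  star_inner := fun x y => Subtype.ext (by
    change ContinuousLinearMap.adjoint _ = _
    rw [ContinuousLinearMap.adjoint_comp, ContinuousLinearMap.adjoint_adjoint])
  inner_self_nonneg := fun x => by
    rw [ContinuousLinearMap.nonneg_iff_isPositive]
    exact ContinuousLinearMap.isPositive_adjoint_comp_self _
  inner_self_eq_zero := fun x hx => by
    have h : ContinuousLinearMap.adjoint (x : K₁ →L[ℂ] K₂) ∘L (x : K₁ →L[ℂ] K₂) = 0 :=
      congrArg Subtype.val hx
    have h2 := ContinuousLinearMap.norm_adjoint_comp_self (x : K₁ →L[ℂ] K₂)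
    rw [h, norm_zero] at h2
    exact Subtype.ext (norm_eq_zero.1 (mul_self_eq_zero.1 h2.symm))

end PreHilbertModule

/-! ## The modules of a projection -/

section Projection

variable {Γ : Type*} [Group Γ] {H : Type*} [NormedAddCommGroup H] [InnerProductSpace ℂ H]

/-- The subspace `p (H ⊗ C*_r(Γ))` of `H ⊗ C*_r(Γ)`. -/
def rangeOn (p : EllTwo Γ H →L[ℂ] EllTwo Γ H) :
    Submodule ℂ (EllTwo Γ ℂ →L[ℂ] EllTwo Γ H) :=
  (stdModule Γ H).map
    (ContinuousLinearMap.compL ℂ (EllTwo Γ ℂ) (EllTwo Γ H) (EllTwo Γ H) p).toLinearMap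

theorem rangeOn_le {S : GeneratingSet Γ} {p : EllTwo Γ H →L[ℂ] EllTwo Γ H}
    (hp : p ∈ HinfCompact S H) : rangeOn p ≤ stdModule Γ H := by
  rintro _ ⟨x, hx, rfl⟩
  exact comp_stdModule hp hx

theorem rangeOn_comp {p : EllTwo Γ H →L[ℂ] EllTwo Γ H}
    {x : EllTwo Γ ℂ →L[ℂ] EllTwo Γ H} (hx : x ∈ rangeOn p)
    {a : EllTwo Γ ℂ →L[ℂ] EllTwo Γ ℂ} (ha : a ∈ reducedCStar Γ) : x ∘L a ∈ rangeOn p := by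
  obtain ⟨y, hy, rfl⟩ := hx
  exact ⟨y ∘L a, stdModule_comp hy ha, rfl⟩

variable [CompleteSpace H]

/-- `P = p (H ⊗ C*_r(Γ))` as a module over `C*_r(Γ)`. -/
def projModule {S : GeneratingSet Γ} {p : EllTwo Γ H →L[ℂ] EllTwo Γ H}
    (hp : p ∈ HinfCompact S H) : PreHilbertModule (reducedCStar Γ) :=
  PreHilbertModule.ofOperators (reducedCStar Γ) (rangeOn p)
    (fun _ hx _ ha => rangeOn_comp hx ha)
    (fun _ hx _ hy => adjoint_comp_mem (rangeOn_le hp hx) (rangeOn_le hp hy))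

/-- `P ∩ H^∞(Γ, H)` as a pre-Hilbert module over `H^∞(Γ)`. -/
def smoothProjModule {S : GeneratingSet Γ} (hS : S.PolynomialGrowth)
    (p : EllTwo Γ H →L[ℂ] EllTwo Γ H) : PreHilbertModule (Hinf S hS) :=
  PreHilbertModule.ofOperators (Hinf S hS) (rangeOn p ⊓ HinfVec S hS H)
    (fun x hx a ha => ⟨rangeOn_comp hx.1 (Hinf_le S hS ha),
      (mem_HinfVec_iff S _).2 (((mem_HinfVec_iff S x).1 hx.2).comp hS
        ((mem_Hinf_iff S a).1 ha))⟩)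
    (fun x hx y hy => (mem_Hinf_iff S _).2
      (((mem_HinfVec_iff S x).1 hx.2).adjoint.comp hS ((mem_HinfVec_iff S y).1 hy.2)))

end Projection

end

/-!
The two existence statements are compared through finite Parseval frames.  For any pre-Hilbert
module `M` over `S`, there is a `Q` with `M ⊕ Q ≅ Sⁿ` exactly when there are `ξ₁, …, ξₙ ∈ M` with
`x = ∑ ξᵢ (ξᵢ | x)` for all `x ∈ M` (`exists_isParsevalFrame`,
`IsParsevalFrame.directSum_frameComplement`): the components in `M` of the standard basis of `Sⁿ`
form such a frame, and conversely `Q` is the kernel of `a ↦ ∑ ξᵢ aᵢ`, which is complete if `S` is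
closed.  For the modules of the projection `p` the frame condition says `∑ ξᵢ ξᵢ^* = p`.  The
theorem therefore asks to pass between frames of `P` and frames of `P ∩ H^∞(Γ, H)` with the same number
of elements.

A frame of `P ∩ H^∞(Γ, H)` is a frame of `P` by density.  Conversely, approximate a frame of `P` by
elements `ηᵢ` of `P ∩ H^∞(Γ, H)`.  Then `a = ∑ ηᵢ ηᵢ^* + (1 - p)` is close to `1`, and the elements
`a^{-1/2} ηᵢ` form a frame (`exists_isParsevalFrame_of_norm_lt`); they stay rapidly decreasing
because `a^{-1/2}` has rapidly decreasing coefficients (`IsRapid.exists_inv_sqrt`).  The same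
correction, applied to `p (hᵢ ⊗ 1)` for an orthonormal basis `h` of a large finite-dimensional
subspace of `H`, produces some finite frame: since the coefficients of `p` are compact,
`∑ p (hᵢ ⊗ 1) (hᵢ ⊗ 1)^* p` is close to `p`.  This gives finite generation and projectivity.

The stability of rapidly decreasing operators under `a ↦ a^{-1/2}` rests on a characterization by
commutators.  Let `D_R` be the multiplication by `min(L, R)`.  A right-invariant operator `T` on
`E ⊗ ℓ²(Γ)` is rapidly decreasing if and only if each iterated commutator
`[D_R, [D_R, … [D_R, T]]]` is bounded uniformly in `R`
(`IsRapid.hasBoundedCommutators`, `isRapid_of_hasBoundedCommutators`): the truncated length changes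
by at most `L(γ)` under translation by `γ`, and the matrix entry at `(γ, 1)` of the `n`-fold
commutator is `min(L(γ), R)ⁿ` times the coefficient at `γ`.  Bounded commutators pass to
inverses, since `[D, T⁻¹] = -T⁻¹ [D, T] T⁻¹`, and to square roots `b` of `a` near `1`, since
`[D, b]` solves the Sylvester equation `y b + b y = [D, a]`.
-/

/-! ### Parseval frames in pre-Hilbert modules -/

namespace PreHilbertModule

variable {B : Type*} [CStarAlgebra B] [PartialOrder B] [StarOrderedRing B]
  {S : StarSubalgebra ℂ B}

/-- A finite Parseval frame of `M`: the reconstruction formula `x = ∑ ξᵢ (ξᵢ | x)` holds for all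
`x`.  Equivalently, `x ↦ ((ξᵢ | x))ᵢ` embeds `M` isometrically as an orthogonal direct summand of
`Sⁿ`. -/
def IsParsevalFrame (M : PreHilbertModule S) {n : ℕ} (ξ : Fin n → M.carrier) : Prop :=
  ∀ x, ∑ i, MulOpposite.op (M.inner (ξ i) x) • ξ i = x

variable (M : PreHilbertModule S)

theorem inner_zero_right (x : M.carrier) : M.inner x 0 = 0 := by
  have h := M.inner_add_right x 0 0
  rw [add_zero] at h
  simpa using h

theorem inner_sum_right {ι : Type*} (s : Finset ι) (x : M.carrier) (y : ι → M.carrier) :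
    M.inner x (∑ i ∈ s, y i) = ∑ i ∈ s, M.inner x (y i) :=
  map_sum (⟨⟨M.inner x, M.inner_zero_right x⟩, M.inner_add_right x⟩ : M.carrier →+ S) y s

theorem inner_add_left (x y z : M.carrier) :
    M.inner (x + y) z = M.inner x z + M.inner y z := by
  rw [← M.star_inner z (x + y), M.inner_add_right, star_add, M.star_inner, M.star_inner]

/-- The analysis map `x ↦ ((ξᵢ | x))ᵢ` of a finite family `ξ`. -/
def analysis {n : ℕ} (ξ : Fin n → M.carrier) : M.carrier →ₗ[(↥S)ᵐᵒᵖ] (Fin n → S) where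
  toFun x i := M.inner (ξ i) x
  map_add' x y := by funext i; exact M.inner_add_right _ _ _
  map_smul' a x := by funext i; exact M.inner_smul_right _ _ a.unop

/-- The synthesis map `a ↦ ∑ ξᵢ aᵢ` of a finite family `ξ`. -/
def synthesis {n : ℕ} (ξ : Fin n → M.carrier) : (Fin n → S) →ₗ[(↥S)ᵐᵒᵖ] M.carrier where
  toFun a := ∑ i, MulOpposite.op (a i) • ξ i
  map_add' a b := by simp [add_smul, Finset.sum_add_distrib]
  map_smul' c a := by
    simp only [Finset.smul_sum, smul_smul, Pi.smul_apply, RingHom.id_apply]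
    rfl

variable {M}

theorem IsParsevalFrame.synthesis_analysis {n : ℕ} {ξ : Fin n → M.carrier}
    (hξ : M.IsParsevalFrame ξ) (x : M.carrier) : M.synthesis ξ (M.analysis ξ x) = x := hξ x

/-- The analysis map is the adjoint of the synthesis map. -/
theorem free_inner_analysis {n : ℕ} (ξ : Fin n → M.carrier) (x : M.carrier) (a : Fin n → S) :
    (free S n).inner (M.analysis ξ x) a = M.inner x (M.synthesis ξ a) := by
  have h : M.inner x (M.synthesis ξ a) = ∑ i, M.inner x (ξ i) * a i := by
    simp only [synthesis, LinearMap.coe_mk, AddHom.coe_mk, inner_sum_right, M.inner_smul_right]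
  rw [h]
  change ∑ i, star (M.inner (ξ i) x) * a i = _
  simp only [M.star_inner]

/-- An embedding of `M` as a summand of `Sⁿ` yields a Parseval frame: the components in `M` of the
standard basis of `Sⁿ`. -/
theorem exists_isParsevalFrame {Q : PreHilbertModule S} {n : ℕ}
    (h : (M.directSum Q).Isomorphic (free S n)) :
    ∃ ξ : Fin n → M.carrier, M.IsParsevalFrame ξ := by
  classical
  obtain ⟨e, he⟩ := h
  let ε : Fin n → (free S n).carrier := fun i => (Pi.single i 1 : Fin n → S)
  refine ⟨fun i => (e.symm (ε i)).1, fun x => ?_⟩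
  let x' : (M.directSum Q).carrier := (x, 0)
  have h1 : ∀ i, M.inner (e.symm (ε i)).1 x = (e x' : Fin n → S) i := fun i => by
    have h2 : (free S n).inner (ε i) (e x') = (M.directSum Q).inner (e.symm (ε i)) x' := by
      rw [← he, e.apply_symm_apply]
    have h3 : (M.directSum Q).inner (e.symm (ε i)) x' =
        M.inner (e.symm (ε i)).1 x + Q.inner (e.symm (ε i)).2 0 := rfl
    rw [h3, inner_zero_right, add_zero] at h2
    rw [← h2]
    have h4 : (free S n).inner (ε i) (e x') =
        ∑ j, star ((Pi.single i 1 : Fin n → S) j) * (e x' : Fin n → S) j := rfl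
    rw [h4, Finset.sum_eq_single i]
    · simp
    · intro j _ hj
      simp [hj]
    · simp
  have h5 : e.symm (e x') = ∑ i, MulOpposite.op ((e x' : Fin n → S) i) • e.symm (ε i) := by
    simp only [← map_smul, ← map_sum]
    congr 1
    change (e x' : Fin n → S) = ∑ i, MulOpposite.op ((e x' : Fin n → S) i) •
      (Pi.single i 1 : Fin n → S)
    funext j
    rw [Finset.sum_apply, Finset.sum_eq_single j]
    · simp
    · intro k _ hk
      simp [hk.symm]
    · simp
  rw [e.symm_apply_apply] at h5
  simp only [h1]
  have h6 := congrArg (LinearMap.fst (↥S)ᵐᵒᵖ M.carrier Q.carrier) h5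
  exact (h6.trans (map_sum (LinearMap.fst (↥S)ᵐᵒᵖ M.carrier Q.carrier) _ _)).symm

/-- A submodule of a pre-Hilbert module with the restricted inner product. -/
def restrict (M : PreHilbertModule S) (N : Submodule (↥S)ᵐᵒᵖ M.carrier) :
    PreHilbertModule S where
  carrier := N
  inner x y := M.inner x y
  inner_add_right x y z := M.inner_add_right x y z
  inner_smul_right x y a := M.inner_smul_right x y a
  star_inner x y := M.star_inner x y
  inner_self_nonneg x := M.inner_self_nonneg x
  inner_self_eq_zero x hx := Subtype.ext (M.inner_self_eq_zero x hx)

/-- The orthogonal complement of `M` in `Sⁿ` for the embedding given by a Parseval frame: the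
kernel of the synthesis map. -/
def frameComplement (M : PreHilbertModule S) {n : ℕ} (ξ : Fin n → M.carrier) :
    PreHilbertModule S :=
  (free S n).restrict (LinearMap.ker (M.synthesis ξ))

theorem IsParsevalFrame.directSum_frameComplement {n : ℕ} {ξ : Fin n → M.carrier}
    (hξ : M.IsParsevalFrame ξ) :
    (M.directSum (M.frameComplement ξ)).Isomorphic (free S n) := by
  have hv := hξ.synthesis_analysis
  let f : M.carrier × LinearMap.ker (M.synthesis ξ) →ₗ[(↥S)ᵐᵒᵖ] (Fin n → S) :=
    (M.analysis ξ).coprod (LinearMap.ker (M.synthesis ξ)).subtype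
  have hf : ∀ q, f q = M.analysis ξ q.1 + q.2 := fun q => rfl
  have hsf : ∀ q, M.synthesis ξ (f q) = q.1 := fun q => by
    rw [hf, map_add, hv, LinearMap.mem_ker.1 q.2.2, add_zero]
  have hbij : Function.Bijective f := by
    constructor
    · intro q r hqr
      have h1 : q.1 = r.1 := by rw [← hsf q, hqr, hsf r]
      refine Prod.ext h1 (Subtype.ext ?_)
      rw [hf, hf, h1] at hqr
      exact add_left_cancel hqr
    · intro a
      refine ⟨(M.synthesis ξ a, ⟨a - M.analysis ξ (M.synthesis ξ a), ?_⟩), ?_⟩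
      · rw [LinearMap.mem_ker, map_sub, hv, sub_self]
      · rw [hf]
        exact add_sub_cancel _ _
  suffices key : ∀ (x y : M.carrier) (a b : LinearMap.ker (M.synthesis ξ)),
      (free S n).inner (M.analysis ξ x + a : Fin n → S) (M.analysis ξ y + b : Fin n → S) =
        M.inner x y + (free S n).inner (a : Fin n → S) (b : Fin n → S) from
    ⟨LinearEquiv.ofBijective f hbij, fun q r => key q.1 r.1 q.2 r.2⟩
  intro x y a b
  have hxk : ∀ (x : M.carrier) (a : LinearMap.ker (M.synthesis ξ)),
      (free S n).inner (M.analysis ξ x) (a : Fin n → S) = 0 := fun x a => by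
    rw [free_inner_analysis, LinearMap.mem_ker.1 a.2, inner_zero_right]
  have hkx : (free S n).inner (a : Fin n → S) (M.analysis ξ y) = 0 :=
    ((free S n).star_inner _ _).symm.trans ((congrArg star (hxk y a)).trans (star_zero _))
  have e : (free S n).inner (M.analysis ξ x + a : Fin n → S) (M.analysis ξ y + b : Fin n → S) =
      (free S n).inner (M.analysis ξ x) (M.analysis ξ y) +
        (free S n).inner (M.analysis ξ x) (b : Fin n → S) +
        ((free S n).inner (a : Fin n → S) (M.analysis ξ y) +
        (free S n).inner (a : Fin n → S) (b : Fin n → S)) :=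
    ((free S n).inner_add_left _ _ _).trans
      (congrArg₂ (· + ·) ((free S n).inner_add_right _ _ _) ((free S n).inner_add_right _ _ _))
  rw [e, hkx, hxk, free_inner_analysis, hv, add_zero, zero_add]

/-- Norm convergence in `Sⁿ` is coordinatewise, and the kernel of synthesis is closed. -/
theorem isHilbert_frameComplement (hS : IsClosed (S : Set B)) {n : ℕ} {ξ : Fin n → M.carrier}
    (hξ : M.IsParsevalFrame ξ) : (M.frameComplement ξ).IsHilbert := by
  intro x hx
  let c : ℕ → Fin n → S := fun m => (x m).1
  have hinner : ∀ a : Fin n → S, (((free S n).inner a a : S) : B) =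
      ∑ i, star (a i : B) * (a i : B) := fun a => by
    change ((∑ i, star (a i) * a i : S) : B) = _
    simp
  have hcoord : ∀ (a : Fin n → S) (i : Fin n), ‖a i‖ ≤ (free S n).norm a := fun a i => by
    refine Real.le_sqrt_of_sq_le ?_
    rw [hinner, sq]
    change ‖(a i : B)‖ * ‖(a i : B)‖ ≤ _
    rw [← CStarRing.norm_star_mul_self]
    exact CStarAlgebra.norm_le_norm_of_nonneg_of_le (star_mul_self_nonneg _)
      (Finset.single_le_sum (f := fun j => star (a j : B) * (a j : B))
        (fun j _ => star_mul_self_nonneg _) (Finset.mem_univ i))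
  have : CompleteSpace S := hS.completeSpace_coe
  have hcau : ∀ i, CauchySeq fun m => c m i := fun i => by
    refine Metric.cauchySeq_iff.2 fun ε hε => ?_
    obtain ⟨N, hN⟩ := hx ε hε
    refine ⟨N, fun m hm k hk => ?_⟩
    rw [dist_eq_norm]
    exact (hcoord (c m - c k) i).trans_lt (hN m hm k hk)
  choose y hy using fun i => cauchySeq_tendsto_of_complete (hcau i)
  have hyker : M.synthesis ξ y = 0 := by
    -- Since the analysis map is injective, the kernel of synthesis is cut out by continuous
    -- equations between the coordinates.
    have h0 : M.analysis ξ (M.synthesis ξ y) = 0 := by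
      have hG : ∀ (a : Fin n → S) j, M.analysis ξ (M.synthesis ξ a) j =
          ∑ i, M.inner (ξ j) (ξ i) * a i := fun a j => by
        simp only [synthesis, analysis, LinearMap.coe_mk, AddHom.coe_mk, inner_sum_right,
          M.inner_smul_right]
      funext j
      rw [hG]
      have hlim : Filter.Tendsto (fun m => ∑ i, M.inner (ξ j) (ξ i) * c m i) Filter.atTop
          (nhds (∑ i, M.inner (ξ j) (ξ i) * y i)) :=
        tendsto_finsetSum _ fun i _ => (hy i).const_mul _
      refine tendsto_nhds_unique hlim ?_
      have hz : ∀ m, ∑ i, M.inner (ξ j) (ξ i) * c m i = 0 := fun m => by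
        have h1 : M.synthesis ξ (c m) = 0 := LinearMap.mem_ker.1 (x m).2
        rw [← hG, h1, map_zero, Pi.zero_apply]
      simp only [hz]
      exact tendsto_const_nhds
    rw [← hξ.synthesis_analysis (M.synthesis ξ y), h0, map_zero]
  refine ⟨⟨y, hyker⟩, fun ε hε => ?_⟩
  have hlim : Filter.Tendsto (fun m => (free S n).norm (c m - y : Fin n → S)) Filter.atTop
      (nhds 0) := by
    have h1 : Filter.Tendsto
        (fun m => ∑ i, star ((c m i - y i : S) : B) * ((c m i - y i : S) : B)) Filter.atTop
        (nhds (∑ _i : Fin n, star ((0 : S) : B) * ((0 : S) : B))) := by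
      refine tendsto_finsetSum _ fun i _ => ?_
      have h2 : Filter.Tendsto (fun m => ((c m i - y i : S) : B)) Filter.atTop
          (nhds ((0 : S) : B)) := by
        have := (hy i).sub_const (y i)
        rw [sub_self] at this
        exact (continuous_subtype_val.tendsto _).comp this
      exact ((continuous_star.tendsto _).comp h2).mul h2
    have h3 := (Real.continuous_sqrt.tendsto _).comp h1.norm
    simp only [ZeroMemClass.coe_zero, mul_zero, Finset.sum_const_zero, norm_zero,
      Real.sqrt_zero] at h3
    refine h3.congr fun m => ?_
    change _ = Real.sqrt _
    rw [hinner]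
    rfl
  obtain ⟨N, hN⟩ := Filter.eventually_atTop.1 (hlim.eventually_lt_const hε)
  exact ⟨N, fun m hm => hN m hm⟩

/-- `S` is a free right module of rank one over itself. -/
def opSelfEquiv (S : StarSubalgebra ℂ B) : (↥S)ᵐᵒᵖ ≃ₗ[(↥S)ᵐᵒᵖ] S where
  toFun a := a.unop
  invFun a := MulOpposite.op a
  map_add' _ _ := rfl
  map_smul' _ _ := rfl
  left_inv _ := rfl
  right_inv _ := rfl

theorem IsParsevalFrame.finite {n : ℕ} {ξ : Fin n → M.carrier} (hξ : M.IsParsevalFrame ξ) :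
    Module.Finite (↥S)ᵐᵒᵖ M.carrier := by
  have : Module.Finite (↥S)ᵐᵒᵖ S := Module.Finite.equiv (opSelfEquiv S)
  exact Module.Finite.of_surjective (M.synthesis ξ) fun x => ⟨_, hξ.synthesis_analysis x⟩

theorem IsParsevalFrame.projective {n : ℕ} {ξ : Fin n → M.carrier} (hξ : M.IsParsevalFrame ξ) :
    Module.Projective (↥S)ᵐᵒᵖ M.carrier := by
  have : Module.Free (↥S)ᵐᵒᵖ S := Module.Free.of_equiv (opSelfEquiv S)
  exact Module.Projective.of_split (M.analysis ξ) (M.synthesis ξ)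
    (LinearMap.ext hξ.synthesis_analysis)

end PreHilbertModule

/-! ### Uniformly bounded iterated commutators -/

section IteratedCommutators

variable {ι A : Type*} [NormedRing A] [NormedAlgebra ℂ A]

/-- The family `T` has uniformly bounded commutators with `D` up to order `n`: for `m ≤ n`, the
`m`-fold commutators `[Dᵢ, [Dᵢ, … [Dᵢ, Tᵢ]]]` are bounded uniformly in `i`. -/
def HasBoundedCommutators (D : ι → A) (n : ℕ) (T : ι → A) : Prop :=
  ∀ m ≤ n, ∃ C : ℝ, ∀ i, ‖(fun x => D i * x - x * D i)^[m] (T i)‖ ≤ C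

namespace HasBoundedCommutators

variable {D : ι → A} {n : ℕ} {T U : ι → A}

theorem zero_iff : HasBoundedCommutators D 0 T ↔ ∃ C : ℝ, ∀ i, ‖T i‖ ≤ C :=
  ⟨fun h => h 0 le_rfl, fun h m hm => by obtain rfl := Nat.le_zero.1 hm; exact h⟩

theorem succ_iff : HasBoundedCommutators D (n + 1) T ↔
    (∃ C : ℝ, ∀ i, ‖T i‖ ≤ C) ∧ HasBoundedCommutators D n fun i => D i * T i - T i * D i := by
  refine ⟨fun h => ⟨h 0 (Nat.zero_le _), fun m hm => h (m + 1) (Nat.succ_le_succ hm)⟩,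
    fun h m hm => ?_⟩
  cases m with
  | zero => exact h.1
  | succ m => exact h.2 m (Nat.le_of_succ_le_succ hm)

theorem of_succ (h : HasBoundedCommutators D (n + 1) T) : HasBoundedCommutators D n T :=
  fun m hm => h m (hm.trans (Nat.le_succ n))

theorem bounded (h : HasBoundedCommutators D n T) : ∃ C : ℝ, ∀ i, ‖T i‖ ≤ C :=
  h 0 (Nat.zero_le n)

theorem add (hT : HasBoundedCommutators D n T) (hU : HasBoundedCommutators D n U) :
    HasBoundedCommutators D n fun i => T i + U i := by
  induction n generalizing T U with
  | zero =>
    obtain ⟨C, hC⟩ := hT.bounded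
    obtain ⟨C', hC'⟩ := hU.bounded
    exact zero_iff.2 ⟨C + C', fun i => (norm_add_le _ _).trans (add_le_add (hC i) (hC' i))⟩
  | succ n ih =>
    obtain ⟨C, hC⟩ := hT.bounded
    obtain ⟨C', hC'⟩ := hU.bounded
    refine succ_iff.2
      ⟨⟨C + C', fun i => (norm_add_le _ _).trans (add_le_add (hC i) (hC' i))⟩, ?_⟩
    convert ih (succ_iff.1 hT).2 (succ_iff.1 hU).2 using 2 with i
    noncomm_ring

theorem neg (hT : HasBoundedCommutators D n T) : HasBoundedCommutators D n fun i => -T i := by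
  induction n generalizing T with
  | zero =>
    obtain ⟨C, hC⟩ := hT.bounded
    exact zero_iff.2 ⟨C, fun i => (norm_neg (T i)).trans_le (hC i)⟩
  | succ n ih =>
    obtain ⟨C, hC⟩ := hT.bounded
    refine succ_iff.2 ⟨⟨C, fun i => (norm_neg (T i)).trans_le (hC i)⟩, ?_⟩
    convert ih (succ_iff.1 hT).2 using 2 with i
    noncomm_ring

theorem bounded_mul (hT : ∃ C : ℝ, ∀ i, ‖T i‖ ≤ C) (hU : ∃ C : ℝ, ∀ i, ‖U i‖ ≤ C) :
    ∃ C : ℝ, ∀ i, ‖T i * U i‖ ≤ C := by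
  obtain ⟨C, hC⟩ := hT
  obtain ⟨C', hC'⟩ := hU
  exact ⟨C * C', fun i => (norm_mul_le _ _).trans
    (mul_le_mul (hC i) (hC' i) (norm_nonneg _) ((norm_nonneg _).trans (hC i)))⟩

theorem mul (hT : HasBoundedCommutators D n T) (hU : HasBoundedCommutators D n U) :
    HasBoundedCommutators D n fun i => T i * U i := by
  induction n generalizing T U with
  | zero => exact zero_iff.2 (bounded_mul hT.bounded hU.bounded)
  | succ n ih =>
    refine succ_iff.2 ⟨bounded_mul hT.bounded hU.bounded, ?_⟩
    convert (ih (succ_iff.1 hT).2 hU.of_succ).add (ih hT.of_succ (succ_iff.1 hU).2) using 2 with i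
    noncomm_ring

/-- Closure under inverses, from `[D, T⁻¹] = -T⁻¹ [D, T] T⁻¹`. -/
theorem inv {a b : A} (hab : a * b = 1) (hba : b * a = 1)
    (ha : HasBoundedCommutators D n fun _ => a) : HasBoundedCommutators D n fun _ => b := by
  induction n with
  | zero => exact zero_iff.2 ⟨‖b‖, fun _ => le_rfl⟩
  | succ n ih =>
    have hb := ih ha.of_succ
    refine succ_iff.2 ⟨⟨‖b‖, fun _ => le_rfl⟩, ?_⟩
    convert ((hb.mul (succ_iff.1 ha).2).mul hb).neg using 2 with i
    have e : -(b * (D i * a - a * D i) * b) = (b * a) * D i * b - b * D i * (a * b) := by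
      noncomm_ring
    rw [e, hab, hba, one_mul, mul_one]

/-- Regularity for the Sylvester equation `y b + b y = z` with `b` close to `1`.  Such a `b` gives
the a priori estimate `2 (1 - ‖1 - b‖) ‖y‖ ≤ ‖z‖`, and the commutator `[D, y]` solves a Sylvester
equation with the same `b`. -/
theorem of_sylvester {b : A} (hb1 : ‖1 - b‖ < 1) {y z : ι → A}
    (hyz : ∀ i, y i * b + b * y i = z i) (hb : HasBoundedCommutators D n fun _ => b)
    (hz : HasBoundedCommutators D n z) : HasBoundedCommutators D n y := by
  have key : ∀ {y z : ι → A}, (∀ i, y i * b + b * y i = z i) → (∃ C : ℝ, ∀ i, ‖z i‖ ≤ C) →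
      ∃ C : ℝ, ∀ i, ‖y i‖ ≤ C := by
    rintro y z hyz ⟨C, hC⟩
    refine ⟨C / (2 * (1 - ‖1 - b‖)), fun i => ?_⟩
    rw [le_div_iff₀ (by linarith)]
    have e : y i + y i = z i + (y i * (1 - b) + (1 - b) * y i) := by
      rw [← hyz]; noncomm_ring
    have h1 : ‖y i * (1 - b) + (1 - b) * y i‖ ≤ 2 * ‖1 - b‖ * ‖y i‖ :=
      (norm_add_le_of_le (norm_mul_le _ _) (norm_mul_le _ _)).trans_eq (by ring)
    have h2 : y i + y i - (y i * (1 - b) + (1 - b) * y i) = z i := by rw [e]; abel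
    have h3 : ‖y i + y i‖ = 2 * ‖y i‖ := by
      rw [← two_smul ℂ (y i), norm_smul, RCLike.norm_two]
    have h4 := norm_sub_norm_le (y i + y i) (y i * (1 - b) + (1 - b) * y i)
    rw [h2, h3] at h4
    nlinarith [hC i]
  induction n generalizing y z with
  | zero => exact zero_iff.2 (key hyz hz.bounded)
  | succ n ih =>
    refine succ_iff.2 ⟨key hyz hz.bounded, ?_⟩
    have hy := ih hyz hb.of_succ hz.of_succ
    have hdb := (succ_iff.1 hb).2
    refine ih (fun i => ?_) hb.of_succ
      ((succ_iff.1 hz).2.add ((hy.mul hdb).add (hdb.mul hy)).neg)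
    rw [← hyz]
    noncomm_ring

/-- Closure under square roots close to `1`: if `b² = a` then `[D, b] b + b [D, b] = [D, a]`. -/
theorem sqrt {a b : A} (hb1 : ‖1 - b‖ < 1) (hab : b * b = a)
    (ha : HasBoundedCommutators D n fun _ => a) : HasBoundedCommutators D n fun _ => b := by
  induction n with
  | zero => exact zero_iff.2 ⟨‖b‖, fun _ => le_rfl⟩
  | succ n ih =>
    refine succ_iff.2 ⟨⟨‖b‖, fun _ => le_rfl⟩, ?_⟩
    refine of_sylvester hb1 (fun i => ?_) (ih ha.of_succ) (succ_iff.1 ha).2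
    rw [← hab]
    noncomm_ring

end HasBoundedCommutators

end IteratedCommutators

/-! ### Point masses, right translations and truncated length operators -/

namespace EllTwo

variable {Γ : Type*} {E : Type*} [NormedAddCommGroup E] [InnerProductSpace ℂ E]

open Classical in
/-- The embedding `e ↦ e ⊗ δ_g` of `E` in `E ⊗ ℓ²(Γ)`. -/
noncomputable def pointMass (E : Type*) [NormedAddCommGroup E] [InnerProductSpace ℂ E] (g : Γ) :
    E →L[ℂ] EllTwo Γ E :=
  (lp.singleContinuousLinearMap ℂ (fun _ : Γ => E) 2 g : E →L[ℂ] lp (fun _ : Γ => E) 2)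

open Classical in
theorem pointMass_apply (g : Γ) (e : E) (x : Γ) : pointMass E g e x = if x = g then e else 0 := by
  change lp.single (E := fun _ : Γ => E) 2 g e x = _
  rw [lp.single_apply, Pi.single_apply]

@[simp]
theorem pointMass_apply_self (g : Γ) (e : E) : pointMass E g e g = e := by
  rw [pointMass_apply, if_pos rfl]

theorem norm_pointMass_apply (g : Γ) (e : E) : ‖pointMass E g e‖ = ‖e‖ := by
  classical
  exact lp.norm_single (E := fun _ : Γ => E) (p := 2) (by norm_num) g e

theorem norm_pointMass_le (g : Γ) : ‖(pointMass E g : E →L[ℂ] EllTwo Γ E)‖ ≤ 1 :=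
  ContinuousLinearMap.opNorm_le_bound _ zero_le_one fun e => by rw [norm_pointMass_apply, one_mul]

theorem hasSum_pointMass (ξ : EllTwo Γ E) : HasSum (fun g => pointMass E g (ξ g)) ξ := by
  classical
  exact lp.hasSum_single (E := fun _ : Γ => E) (p := 2) (by norm_num) ξ

/-- Bounded operators are determined by their values on point masses. -/
theorem clm_ext {K : Type*} [NormedAddCommGroup K] [NormedSpace ℂ K]
    {T U : EllTwo Γ E →L[ℂ] K} (h : ∀ g e, T (pointMass E g e) = U (pointMass E g e)) :
    T = U := by
  ext ξ
  have h1 := T.hasSum (hasSum_pointMass ξ)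
  simp only [h] at h1
  exact h1.unique (U.hasSum (hasSum_pointMass ξ))

theorem norm_apply_le (ξ : EllTwo Γ E) (x : Γ) : ‖ξ x‖ ≤ ‖ξ‖ := by
  refine (sq_le_sq₀ (norm_nonneg _) (norm_nonneg _)).1 ?_
  rw [norm_sq]
  exact ξ.summable.le_tsum x fun _ _ => by positivity

/-- Evaluation at a point. -/
noncomputable def evalAt (E : Type*) [NormedAddCommGroup E] [InnerProductSpace ℂ E] (x : Γ) :
    EllTwo Γ E →L[ℂ] E :=
  LinearMap.mkContinuous
    { toFun := fun ξ => ξ x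
      map_add' := fun _ _ => rfl
      map_smul' := fun _ _ => rfl }
    1 (fun ξ => (norm_apply_le ξ x).trans_eq (one_mul _).symm)

@[simp]
theorem evalAt_apply (ξ : EllTwo Γ E) (x : Γ) : evalAt E x ξ = ξ x := rfl

theorem norm_evalAt_le (x : Γ) : ‖evalAt (Γ := Γ) E x‖ ≤ 1 :=
  LinearMap.mkContinuous_norm_le _ zero_le_one _

theorem summable_mul {f : Γ → ℝ} {C : ℝ} (hf : ∀ x, |f x| ≤ C) (ξ : EllTwo Γ E) :
    Summable fun x => ‖(f x : ℂ) • ξ x‖ ^ 2 := by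
  refine Summable.of_nonneg_of_le (fun x => by positivity) (fun x => ?_)
    (ξ.summable.mul_left (C ^ 2))
  rw [norm_smul, mul_pow, Complex.norm_real, Real.norm_eq_abs]
  have := hf x
  gcongr

/-- Multiplication by a bounded real function. -/
noncomputable def mulOp (E : Type*) [NormedAddCommGroup E] [InnerProductSpace ℂ E] (f : Γ → ℝ)
    {C : ℝ} (hf : ∀ x, |f x| ≤ C) : EllTwo Γ E →L[ℂ] EllTwo Γ E :=
  LinearMap.mkContinuous
    { toFun := fun ξ => mk (fun x => (f x : ℂ) • ξ x) (summable_mul hf ξ)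
      map_add' := fun ξ η => by ext x; simp
      map_smul' := fun c ξ => by ext x; exact smul_comm _ _ _ }
    |C| (fun ξ => by
      refine norm_le (by positivity) ?_
      rw [mul_pow, norm_sq, ← tsum_mul_left]
      refine Summable.tsum_le_tsum (fun x => ?_) (summable_mul hf ξ) (ξ.summable.mul_left _)
      simp only [LinearMap.coe_mk, AddHom.coe_mk, mk_apply]
      rw [norm_smul, mul_pow, Complex.norm_real, Real.norm_eq_abs]
      have := (hf x).trans (le_abs_self C)
      gcongr)

@[simp]
theorem mulOp_apply {f : Γ → ℝ} {C : ℝ} (hf : ∀ x, |f x| ≤ C) (ξ : EllTwo Γ E) (x : Γ) :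
    mulOp E f hf ξ x = (f x : ℂ) • ξ x := rfl

theorem norm_mulOp_le {f : Γ → ℝ} {C : ℝ} (hf : ∀ x, |f x| ≤ C) : ‖mulOp E f hf‖ ≤ |C| :=
  LinearMap.mkContinuous_norm_le _ (abs_nonneg _) _

variable [Group Γ]

theorem summable_rightShift (g : Γ) (ξ : EllTwo Γ E) : Summable fun x => ‖ξ (x * g)‖ ^ 2 :=
  ((Equiv.mulRight g).summable_iff (f := fun x => ‖ξ x‖ ^ 2)).2 ξ.summable

/-- The right translation `(ρ(g) ξ)(x) = ξ(x g)`. -/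
noncomputable def rightShift (E : Type*) [NormedAddCommGroup E] [InnerProductSpace ℂ E] (g : Γ) :
    EllTwo Γ E →L[ℂ] EllTwo Γ E :=
  LinearMap.mkContinuous
    { toFun := fun ξ => mk (fun x => ξ (x * g)) (summable_rightShift g ξ)
      map_add' := fun ξ η => by ext x; simp
      map_smul' := fun c ξ => by ext x; simp }
    1
    (fun ξ => by
      refine norm_le (by positivity) ?_
      rw [one_mul, norm_sq]
      exact ((Equiv.mulRight g).tsum_eq fun x => ‖ξ x‖ ^ 2).le)

@[simp]
theorem rightShift_apply (g : Γ) (ξ : EllTwo Γ E) (x : Γ) : rightShift E g ξ x = ξ (x * g) := rfl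

theorem rightShift_pointMass (g h : Γ) (e : E) :
    rightShift E g (pointMass E h e) = pointMass E (h * g⁻¹) e := by
  classical
  ext x
  simp only [rightShift_apply, pointMass_apply, eq_mul_inv_iff_mul_eq]

end EllTwo

namespace GeneratingSet

variable {Γ : Type*} [Group Γ] (S : GeneratingSet Γ)

theorem length_one : S.length 1 = 0 :=
  Nat.le_zero.1 (by simpa using S.length_le [] (by simp))

/-- The word length truncated at height `R`. -/
noncomputable def truncLength (R : ℕ) (x : Γ) : ℝ := min (S.length x : ℝ) R

theorem abs_truncLength_le (R : ℕ) (x : Γ) : |S.truncLength R x| ≤ R := by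
  rw [truncLength, abs_of_nonneg (le_min (Nat.cast_nonneg _) (Nat.cast_nonneg _))]
  exact min_le_right _ _

theorem abs_truncLength_sub_le (R : ℕ) (g x : Γ) :
    |S.truncLength R x - S.truncLength R (g⁻¹ * x)| ≤ S.length g := by
  have h1 : (S.length x : ℝ) ≤ S.length g + S.length (g⁻¹ * x) := by
    exact_mod_cast (by simpa using S.length_mul_le g (g⁻¹ * x))
  have h2 : (S.length (g⁻¹ * x) : ℝ) ≤ S.length g + S.length x := by
    exact_mod_cast (by simpa [S.length_inv] using S.length_mul_le g⁻¹ x)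
  refine (abs_min_sub_min_le_max _ _ _ _).trans ?_
  rw [sub_self, abs_zero, max_eq_left (abs_nonneg _), abs_le]
  constructor <;> linarith

open EllTwo

variable (E : Type*) [NormedAddCommGroup E] [InnerProductSpace ℂ E]

/-- Multiplication by the word length truncated at height `R`.  The truncation keeps the operator
bounded; its commutators with `k ⊗ λ(γ)` are bounded by `‖k‖ L(γ)` uniformly in `R`. -/
noncomputable def lengthOp (R : ℕ) : EllTwo Γ E →L[ℂ] EllTwo Γ E :=
  mulOp E (S.truncLength R) (S.abs_truncLength_le R)

end GeneratingSet

/-! ### Rapidly decreasing operators and bounded commutators -/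

section Rapid

open EllTwo

variable {Γ : Type*} [Group Γ] {S : GeneratingSet Γ}
  {E : Type*} [NormedAddCommGroup E] [InnerProductSpace ℂ E]

/-- The `n`-fold commutator of `k ⊗ λ(g)` with the multiplication by a function `f` is its product
with the multiplication by `(f - f(g⁻¹ ·))ⁿ`. -/
theorem norm_iterate_commutator_opAt_le (S : GeneratingSet Γ) (R n : ℕ) (k : E →L[ℂ] E) (g : Γ) :
    ‖(fun x => S.lengthOp E R * x - x * S.lengthOp E R)^[n] (opAt k g)‖ ≤
      ‖k‖ * (S.length g : ℝ) ^ n := by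
  have hb : ∀ n x, |(S.truncLength R x - S.truncLength R (g⁻¹ * x)) ^ n| ≤
      (S.length g : ℝ) ^ n := fun n x => by
    rw [abs_pow]
    exact pow_le_pow_left₀ (abs_nonneg _) (S.abs_truncLength_sub_le R g x) n
  have key : (fun x => S.lengthOp E R * x - x * S.lengthOp E R)^[n] (opAt k g) =
      mulOp E _ (hb n) * opAt k g := by
    induction n with
    | zero => ext ξ x; simp
    | succ n ih =>
      rw [Function.iterate_succ_apply', ih]
      ext ξ x
      change (S.truncLength R x : ℂ) • (mulOp E _ (hb n) (opAt k g ξ)) x -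
        mulOp E _ (hb n) (opAt k g (S.lengthOp E R ξ)) x = _
      change _ - ((_ : ℝ) : ℂ) • k ((S.truncLength R (g⁻¹ * x) : ℂ) • ξ (g⁻¹ * x)) =
        ((_ : ℝ) : ℂ) • k (ξ (g⁻¹ * x))
      simp only [mulOp_apply, opAt_apply, map_smul, smul_smul, ← sub_smul]
      congr 1
      push_cast
      ring
  rw [key, mul_comm ‖k‖]
  refine (norm_mul_le _ _).trans (mul_le_mul ?_ (norm_opAt_le k g) (norm_nonneg _) (by positivity))
  exact (norm_mulOp_le _).trans_eq (abs_of_nonneg (by positivity))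

theorem IsRapid.hasBoundedCommutators (hS : S.PolynomialGrowth)
    {T : EllTwo Γ E →L[ℂ] EllTwo Γ E} (hT : IsRapid S T) (n : ℕ) :
    HasBoundedCommutators (S.lengthOp E) n fun _ => T := by
  obtain ⟨k, hk, hkT⟩ := hT
  intro m _
  refine ⟨∑' g, ‖k g‖ * S.weight g ^ m, fun R => ?_⟩
  have h1 : HasSum (fun g => (fun x => S.lengthOp E R * x - x * S.lengthOp E R)^[m]
      (opAt (k g) g)) ((fun x => S.lengthOp E R * x - x * S.lengthOp E R)^[m] T) := by
    clear * - hkT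
    induction m with
    | zero => exact hkT
    | succ m ih =>
      simp only [Function.iterate_succ_apply']
      exact (ih.mul_left _).sub (ih.mul_right _)
  rw [← h1.tsum_eq]
  refine tsum_of_norm_bounded (hk.summable hS m).hasSum fun g => ?_
  refine (norm_iterate_commutator_opAt_le S R m (k g) g).trans ?_
  have : (S.length g : ℝ) ≤ S.weight g := by unfold GeneratingSet.weight; linarith
  gcongr

theorem IsRapid.commute_rightShift {T : EllTwo Γ E →L[ℂ] EllTwo Γ E} (hT : IsRapid S T) (g : Γ) :
    Commute T (rightShift E g) := by
  obtain ⟨k, -, hkT⟩ := hT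
  have h1 := hasSum_comp_right hkT (rightShift E g)
  have h2 := hasSum_comp_left (rightShift E g) hkT
  refine h1.unique (h2.congr_fun fun γ => ?_)
  ext ξ x
  simp [opAt_apply, mul_assoc]

/-- The `m`-fold commutator with the length operator multiplies the entry `(x, 1)` of the matrix
of `T` by the `m`-th power of the truncated length of `x`. -/
theorem evalAt_iterate_commutator (S : GeneratingSet Γ) (R m : ℕ)
    (T : EllTwo Γ E →L[ℂ] EllTwo Γ E) (x : Γ) (e : E) :
    ((fun x => S.lengthOp E R * x - x * S.lengthOp E R)^[m] T) (pointMass E 1 e) x =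
      ((S.truncLength R x : ℂ) ^ m) • T (pointMass E 1 e) x := by
  have h0 : S.lengthOp E R (pointMass E 1 e) = 0 := by
    classical
    ext y
    rw [GeneratingSet.lengthOp, mulOp_apply, pointMass_apply]
    split_ifs with h
    · simp [h, GeneratingSet.truncLength, S.length_one]
    · simp
  induction m with
  | zero => simp
  | succ m ih =>
    rw [Function.iterate_succ_apply', pow_succ', mul_smul, ← ih]
    change (S.truncLength R x : ℂ) •
        ((fun x => S.lengthOp E R * x - x * S.lengthOp E R)^[m] T) (pointMass E 1 e) x -
      ((fun x => S.lengthOp E R * x - x * S.lengthOp E R)^[m] T) (S.lengthOp E R _) x = _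
    rw [h0, map_zero, EllTwo.zero_apply, sub_zero]

/-- A right-invariant operator all of whose iterated commutators with the truncated length
operators are uniformly bounded is rapidly decreasing: its coefficients `k(γ)` satisfy
`‖k(γ)‖ L(γ)ⁿ ≤ Cₙ`, and polynomial growth turns these bounds into summability. -/
theorem isRapid_of_hasBoundedCommutators [CompleteSpace E] (hS : S.PolynomialGrowth)
    {T : EllTwo Γ E →L[ℂ] EllTwo Γ E} (hT : ∀ g, Commute T (rightShift E g))
    (hb : ∀ n, HasBoundedCommutators (S.lengthOp E) n fun _ => T) : IsRapid S T := by
  let k : Γ → E →L[ℂ] E := fun g => evalAt E g ∘L T ∘L pointMass E 1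
  have hk : ∀ g e, k g e = T (pointMass E 1 e) g := fun _ _ => rfl
  have hdecay : ∀ n : ℕ, ∃ C : ℝ, ∀ g, ‖k g‖ * (S.length g : ℝ) ^ n ≤ C := fun n => by
    obtain ⟨C, hC⟩ := hb n n le_rfl
    refine ⟨C, fun g => ?_⟩
    have e : ((S.length g : ℂ) ^ n) • k g = evalAt E g ∘L
        ((fun x => S.lengthOp E (S.length g) * x - x * S.lengthOp E (S.length g))^[n] T) ∘L
          pointMass E 1 := by
      ext v
      simp only [ContinuousLinearMap.comp_apply, evalAt_apply, evalAt_iterate_commutator]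
      simp [GeneratingSet.truncLength, hk]
    have h1 := congrArg norm e
    rw [norm_smul, norm_pow, Complex.norm_natCast, mul_comm] at h1
    rw [h1]
    refine (ContinuousLinearMap.opNorm_comp_le _ _).trans ?_
    refine (mul_le_mul (norm_evalAt_le g) (ContinuousLinearMap.opNorm_comp_le _ _)
      (norm_nonneg _) zero_le_one).trans ?_
    rw [one_mul]
    refine (mul_le_mul (hC _) (norm_pointMass_le 1) (norm_nonneg _)
      ((norm_nonneg _).trans (hC 0))).trans_eq (mul_one C)
  have hsum : ∀ n : ℕ, Summable fun g => ‖k g‖ * S.weight g ^ n := fun n => by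
    obtain ⟨s, -, hs⟩ := hS
    obtain ⟨m, hm⟩ := exists_nat_ge s
    obtain ⟨C, hC⟩ := hdecay (n + m)
    obtain ⟨C', hC'⟩ := hdecay 0
    simp only [pow_zero, mul_one] at hC'
    have h0 : 0 ≤ C' + C :=
      add_nonneg ((norm_nonneg _).trans (hC' 1)) ((by positivity : (0 : ℝ) ≤ _).trans (hC 1))
    refine Summable.of_nonneg_of_le (fun g => ?_) (fun g => ?_)
      (hs.mul_left (2 ^ (n + m - 1) * (C' + C)))
    · have := S.weight_pos g; positivity
    · have hw := S.weight_pos g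
      have hl : (0 : ℝ) ≤ S.length g := Nat.cast_nonneg _
      have h3 : (S.weight g ^ m)⁻¹ ≤ (1 + (S.length g : ℝ)) ^ (-s) := by
        change _ ≤ S.weight g ^ (-s)
        rw [Real.rpow_neg hw.le, ← Real.rpow_natCast]
        have := S.one_le_weight g
        gcongr
      have h4 : S.weight g ^ (n + m) ≤ 2 ^ (n + m - 1) * (1 + (S.length g : ℝ) ^ (n + m)) := by
        have h := add_pow_le zero_le_one hl (n + m)
        rwa [one_pow] at h
      have h5 : ‖k g‖ * S.weight g ^ (n + m) ≤ 2 ^ (n + m - 1) * (C' + C) := by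
        calc ‖k g‖ * S.weight g ^ (n + m)
            ≤ ‖k g‖ * (2 ^ (n + m - 1) * (1 + (S.length g : ℝ) ^ (n + m))) := by gcongr
          _ = 2 ^ (n + m - 1) * (‖k g‖ + ‖k g‖ * (S.length g : ℝ) ^ (n + m)) := by ring
          _ ≤ _ := by gcongr <;> [exact hC' g; exact hC g]
      calc ‖k g‖ * S.weight g ^ n
          = ‖k g‖ * S.weight g ^ (n + m) * (S.weight g ^ m)⁻¹ := by
            rw [pow_add, ← mul_assoc, mul_assoc _ (S.weight g ^ m),
              mul_inv_cancel₀ (pow_pos hw m).ne', mul_one]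
        _ ≤ 2 ^ (n + m - 1) * (C' + C) * (1 + (S.length g : ℝ)) ^ (-s) := by gcongr
  have hrap := GeneratingSet.rapidlyDecreasing_of_summable hsum
  -- `T` and `∑ k(γ) ⊗ λ(γ)` agree on the vectors `e ⊗ δ₁`, hence on all point masses by right
  -- invariance.
  have hsumm : Summable fun g => opAt (k g) g :=
    Summable.of_norm_bounded (by simpa using hsum 0) fun g => norm_opAt_le _ _
  suffices h : T = ∑' g, opAt (k g) g from ⟨k, hrap, h ▸ hsumm.hasSum⟩
  have hT' : IsRapid S (∑' g, opAt (k g) g) := ⟨k, hrap, hsumm.hasSum⟩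
  have h1 : ∀ e, T (pointMass E 1 e) = (∑' g, opAt (k g) g) (pointMass E 1 e) := fun e => by
    classical
    ext x
    have h2 := (evalAt E x).hasSum
      ((ContinuousLinearMap.apply ℂ (EllTwo Γ E) (pointMass E 1 e)).hasSum hsumm.hasSum)
    have h3 := hasSum_single (f := fun g => evalAt E x
      (ContinuousLinearMap.apply ℂ (EllTwo Γ E) (pointMass E 1 e) (opAt (k g) g))) x (by
        intro g hg
        simp only [ContinuousLinearMap.apply_apply, evalAt_apply, opAt_apply, pointMass_apply]
        rw [if_neg, map_zero]
        rw [inv_mul_eq_one]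
        exact hg)
    have h4 := h3.unique h2
    simp only [ContinuousLinearMap.apply_apply, evalAt_apply, opAt_apply, inv_mul_cancel,
      pointMass_apply_self] at h4
    exact h4
  refine clm_ext fun g e => ?_
  have h2 : pointMass E g e = rightShift E g⁻¹ (pointMass E 1 e) := by
    rw [rightShift_pointMass]; simp
  have h3 := DFunLike.congr_fun (hT g⁻¹).eq (pointMass E 1 e)
  have h4 := DFunLike.congr_fun (hT'.commute_rightShift g⁻¹).eq (pointMass E 1 e)
  rw [mul_apply_eq_comp, mul_apply_eq_comp] at h3 h4
  rw [h2, h3, h4, h1]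

end Rapid

/-! ### Inverse square roots of rapidly decreasing operators -/

section InverseSqrt

open EllTwo

variable {Γ : Type*} [Group Γ] {S : GeneratingSet Γ}
  {E F : Type*} [NormedAddCommGroup E] [InnerProductSpace ℂ E]
  [NormedAddCommGroup F] [InnerProductSpace ℂ F]

theorem isRapid_opAt (S : GeneratingSet Γ) (k : E →L[ℂ] F) (g : Γ) : IsRapid S (opAt k g) := by
  classical
  have e : (fun γ => opAt ((Pi.single g k : Γ → E →L[ℂ] F) γ) γ) = Pi.single g (opAt k g) := by
    funext γ
    by_cases h : γ = g
    · subst h; simp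
    · rw [Pi.single_eq_of_ne h, Pi.single_eq_of_ne h]
      exact map_zero (opAtL E F γ)
  refine ⟨Pi.single g k, fun s _ => ?_, e ▸ hasSum_pi_single g _⟩
  refine summable_of_ne_finset_zero (s := {g}) fun γ hγ => ?_
  have : γ ≠ g := by simpa using hγ
  simp [this]

theorem opAt_id_one : opAt (ContinuousLinearMap.id ℂ E) (1 : Γ) = 1 := by
  ext ξ x
  simp [opAt_apply]

theorem isRapid_one (S : GeneratingSet Γ) : IsRapid S (1 : EllTwo Γ E →L[ℂ] EllTwo Γ E) :=
  opAt_id_one (E := E) (Γ := Γ) ▸ isRapid_opAt S _ 1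

/-- A self-adjoint rapidly decreasing operator close to `1` has a rapidly decreasing inverse
square root.  It is the inverse of the square root given by the continuous functional calculus;
bounded commutators pass to square roots and to inverses. -/
theorem IsRapid.exists_inv_sqrt [CompleteSpace E] (hS : S.PolynomialGrowth)
    {a : EllTwo Γ E →L[ℂ] EllTwo Γ E} (ha : IsRapid S a) (hsa : IsSelfAdjoint a)
    (h1 : ‖1 - a‖ < 1) :
    ∃ b, IsRapid S b ∧ IsSelfAdjoint b ∧ b * a * b = 1 ∧ ∀ x, Commute a x → Commute b x := by
  have hspec : ∀ t ∈ spectrum ℝ a, |1 - t| ≤ ‖1 - a‖ := fun t ht => by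
    have h2 := norm_apply_le_norm_cfc (fun t : ℝ => 1 - t) a ht
    rwa [cfc_sub .., cfc_const_one .., cfc_id' ..] at h2
  have hpos : ∀ t ∈ spectrum ℝ a, 0 ≤ t := fun t ht => by
    have := (abs_le.1 (hspec t ht)).2
    linarith
  set c := cfc Real.sqrt a with hc
  have hcc : c * c = a := by
    rw [hc, ← cfc_mul ..]
    conv_rhs => rw [← cfc_id' ℝ a]
    exact cfc_congr fun t ht => Real.mul_self_sqrt (hpos t ht)
  have hc1 : ‖1 - c‖ < 1 := by
    refine lt_of_le_of_lt ?_ h1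
    have h2 : 1 - c = cfc (fun t : ℝ => 1 - Real.sqrt t) a := by
      rw [cfc_sub .., cfc_const_one ..]
    rw [h2]
    refine norm_cfc_le (norm_nonneg _) fun t ht => ?_
    refine le_trans ?_ (hspec t ht)
    -- `|1 - √t| ≤ |1 - √t| (1 + √t) = |1 - t|`
    have h3 : (1 - t) = (1 - Real.sqrt t) * (1 + Real.sqrt t) := by
      nlinarith [Real.mul_self_sqrt (hpos t ht)]
    rw [h3, abs_mul, Real.norm_eq_abs, abs_of_nonneg (by positivity : 0 ≤ 1 + Real.sqrt t)]
    nlinarith [abs_nonneg (1 - Real.sqrt t), Real.sqrt_nonneg t]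
  have hcomm : ∀ x, Commute a x → Commute c x := fun x hx => hsa.commute_cfc hx _
  have hcsa : IsSelfAdjoint c := cfc_predicate ..
  let w : (EllTwo Γ E →L[ℂ] EllTwo Γ E)ˣ := Units.oneSub (1 - c) hc1
  have hw : (w : EllTwo Γ E →L[ℂ] EllTwo Γ E) = c := sub_sub_cancel _ _
  set b : EllTwo Γ E →L[ℂ] EllTwo Γ E := ↑w⁻¹ with hb
  have hcb : c * b = 1 := by rw [← hw]; exact w.mul_inv
  have hbc : b * c = 1 := by rw [← hw]; exact w.inv_mul
  have hbcomm : ∀ x, Commute a x → Commute b x := fun x hx =>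
    Commute.units_inv_left (hw.symm ▸ hcomm x hx)
  refine ⟨b, isRapid_of_hasBoundedCommutators hS
    (fun g => hbcomm _ (ha.commute_rightShift g))
    (fun n => ((ha.hasBoundedCommutators hS n).sqrt hc1 hcc).inv hcb hbc), ?_, ?_, hbcomm⟩
  · have h2 : star b * c = 1 := by
      have h3 := congrArg star hcb
      rwa [star_mul, hcsa.star_eq, star_one] at h3
    change star b = b
    calc star b = star b * (c * b) := by rw [hcb, mul_one]
      _ = b := by rw [← mul_assoc, h2, one_mul]
  · rw [← hcc, ← mul_assoc, hbc, one_mul, hcb]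

end InverseSqrt

/-! ### Frame operators -/

section FrameOperator

variable {K₁ K₂ : Type*} [NormedAddCommGroup K₁] [InnerProductSpace ℂ K₁]
    [CompleteSpace K₁] [NormedAddCommGroup K₂] [InnerProductSpace ℂ K₂] [CompleteSpace K₂]

/-- The frame operator `∑ ξᵢ ξᵢ^*` of a finite family of operators. -/
noncomputable def frameOp {n : ℕ} (ξ : Fin n → K₁ →L[ℂ] K₂) : K₂ →L[ℂ] K₂ :=
  ∑ i, ξ i ∘L ContinuousLinearMap.adjoint (ξ i)

theorem continuous_frameOp {n : ℕ} :
    Continuous (frameOp : (Fin n → K₁ →L[ℂ] K₂) → K₂ →L[ℂ] K₂) := by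
  refine continuous_finsetSum _ fun i _ => (continuous_apply i).clm_comp ?_
  exact (ContinuousLinearMap.adjoint (𝕜 := ℂ) (E := K₁) (F := K₂)).continuous.comp
    (continuous_apply i)

theorem isSelfAdjoint_frameOp {n : ℕ} (ξ : Fin n → K₁ →L[ℂ] K₂) : IsSelfAdjoint (frameOp ξ) := by
  change star (∑ i, _) = ∑ i, _
  rw [star_sum]
  refine Finset.sum_congr rfl fun i _ => ?_
  rw [ContinuousLinearMap.star_eq_adjoint, ContinuousLinearMap.adjoint_comp,
    ContinuousLinearMap.adjoint_adjoint]

theorem frameOp_comp_left {n : ℕ} (b : K₂ →L[ℂ] K₂) (ξ : Fin n → K₁ →L[ℂ] K₂) :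
    frameOp (fun i => b ∘L ξ i) = b * frameOp ξ * star b := by
  simp only [frameOp, Finset.mul_sum, Finset.sum_mul, ContinuousLinearMap.adjoint_comp]
  rfl

theorem mul_frameOp_of_fixed {n : ℕ} {p : K₂ →L[ℂ] K₂} {ξ : Fin n → K₁ →L[ℂ] K₂}
    (h : ∀ i, p ∘L ξ i = ξ i) : p * frameOp ξ = frameOp ξ := by
  simp only [frameOp, Finset.mul_sum]
  refine Finset.sum_congr rfl fun i _ => ?_
  exact congrArg (· ∘L ContinuousLinearMap.adjoint (ξ i)) (h i)

theorem frameOp_mul_of_fixed {n : ℕ} {p : K₂ →L[ℂ] K₂} (hp : IsSelfAdjoint p)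
    {ξ : Fin n → K₁ →L[ℂ] K₂} (h : ∀ i, p ∘L ξ i = ξ i) : frameOp ξ * p = frameOp ξ := by
  have h1 := congrArg star (mul_frameOp_of_fixed h)
  rwa [star_mul, hp.star_eq, (isSelfAdjoint_frameOp ξ).star_eq] at h1

namespace PreHilbertModule

variable {S : StarSubalgebra ℂ (K₁ →L[ℂ] K₁)} {V : Submodule ℂ (K₁ →L[ℂ] K₂)}
    {hV : ∀ x ∈ V, ∀ a ∈ S, x ∘L a ∈ V}
    {hS : ∀ x ∈ V, ∀ y ∈ V, ContinuousLinearMap.adjoint x ∘L y ∈ S}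

theorem isParsevalFrame_ofOperators_iff {n : ℕ} {ξ : Fin n → V} :
    (ofOperators S V hV hS).IsParsevalFrame ξ ↔
      ∀ x ∈ V, frameOp (fun i => (ξ i : K₁ →L[ℂ] K₂)) ∘L x = x := by
  let M := ofOperators S V hV hS
  let ξ' : Fin n → M.carrier := ξ
  have h : ∀ x : M.carrier, (show V from ∑ i, MulOpposite.op (M.inner (ξ' i) x) • ξ' i).1 =
      frameOp (fun i => (ξ i : K₁ →L[ℂ] K₂)) ∘L (show V from x).1 := fun x => by
    refine (map_sum V.subtype _ _).trans ?_
    rw [frameOp, ContinuousLinearMap.finsetSum_comp]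
    rfl
  exact ⟨fun hξ x hx => (h ⟨x, hx⟩).symm.trans (congrArg Subtype.val (hξ ⟨x, hx⟩)),
    fun hξ x => Subtype.ext ((h x).trans (hξ x.1 x.2))⟩

theorem norm_ofOperators (x : V) :
    (ofOperators S V hV hS).norm x = ‖(x : K₁ →L[ℂ] K₂)‖ := by
  change Real.sqrt ‖ContinuousLinearMap.adjoint (x : K₁ →L[ℂ] K₂) ∘L (x : K₁ →L[ℂ] K₂)‖ = _
  rw [ContinuousLinearMap.norm_adjoint_comp_self, Real.sqrt_mul_self (norm_nonneg _)]

theorem isHilbert_ofOperators (hcl : IsClosed (V : Set (K₁ →L[ℂ] K₂))) :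
    (ofOperators S V hV hS).IsHilbert := by
  intro x hx
  have : CompleteSpace V := hcl.completeSpace_coe
  let z : ℕ → V := x
  have hcau : CauchySeq z := by
    refine Metric.cauchySeq_iff.2 fun ε hε => ?_
    obtain ⟨N, hN⟩ := hx ε hε
    refine ⟨N, fun m hm k hk => ?_⟩
    rw [dist_eq_norm]
    exact (norm_ofOperators (z m - z k)).symm.trans_lt (hN m hm k hk)
  obtain ⟨y, hy⟩ := cauchySeq_tendsto_of_complete hcau
  refine ⟨y, fun ε hε => ?_⟩
  obtain ⟨N, hN⟩ := Metric.tendsto_atTop.1 hy ε hε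
  refine ⟨N, fun n hn => ?_⟩
  have h1 := hN n hn
  rw [dist_eq_norm] at h1
  exact (norm_ofOperators (z n - y)).trans_lt h1

end PreHilbertModule

end FrameOperator

/-! ### Finite-rank approximation -/

section Approximation

variable {Γ : Type*} [Group Γ] {H : Type*} [NormedAddCommGroup H] [InnerProductSpace ℂ H]
  [CompleteSpace H]

/-- Finitely many compact operators are simultaneously approximated by their compositions with the
projection to a finite-dimensional subspace, the span of a finite `ε`-net of the images of the unit
ball. -/
theorem exists_starProjection_approx {ι : Type*} (s : Finset ι) {k : ι → H →L[ℂ] H}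
    (hk : ∀ i, IsCompactOperator (k i)) {ε : ℝ} (hε : 0 < ε) :
    ∃ (W : Submodule ℂ H) (_ : FiniteDimensional ℂ W),
      ∀ i ∈ s, ‖(1 - W.starProjection) ∘L k i‖ ≤ ε := by
  have hcpt : IsCompact (⋃ i ∈ s, closure (k i '' Metric.closedBall 0 1)) :=
    s.isCompact_biUnion fun i _ => (hk i).isCompact_closure_image_closedBall 1
  obtain ⟨t, ht, hcover⟩ := Metric.totallyBounded_iff.1 hcpt.totallyBounded ε hε
  have hfin : FiniteDimensional ℂ (Submodule.span ℂ t) := FiniteDimensional.span_of_finite ℂ ht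
  refine ⟨Submodule.span ℂ t, hfin, fun i hi => ?_⟩
  have h1 : ‖1 - (Submodule.span ℂ t).starProjection‖ ≤ 1 :=
    isStarProjection_starProjection.one_sub.norm_le
  refine ContinuousLinearMap.opNorm_le_of_unit_norm hε.le fun x hx => ?_
  have h2 : k i x ∈ ⋃ y ∈ t, Metric.ball y ε := hcover (Set.mem_biUnion hi
    (subset_closure ⟨x, by simp [hx], rfl⟩))
  simp only [Set.mem_iUnion] at h2
  obtain ⟨y, hy, hxy⟩ := h2
  have h3 : (1 - (Submodule.span ℂ t).starProjection) y = 0 := by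
    change y - (Submodule.span ℂ t).starProjection y = 0
    rw [Submodule.starProjection_eq_self_iff.2 (Submodule.subset_span hy), sub_self]
  have h4 : ((1 - (Submodule.span ℂ t).starProjection) ∘L k i) x =
      (1 - (Submodule.span ℂ t).starProjection) (k i x - y) := by
    rw [map_sub, h3, sub_zero]; rfl
  rw [h4]
  refine (ContinuousLinearMap.le_of_opNorm_le _ h1 _).trans ?_
  rw [one_mul, ← dist_eq_norm]
  exact (Metric.mem_ball.1 hxy).le

/-- Compactness of the coefficients: an element of `H^∞(Γ, 𝓚(H))` is almost unchanged by
composition with the projection to a suitable finite-dimensional subspace of `H`. -/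
theorem exists_ampl_approx {S : GeneratingSet Γ} {p : EllTwo Γ H →L[ℂ] EllTwo Γ H}
    (hp : p ∈ HinfCompact S H) :
    ∃ (W : Submodule ℂ H) (_ : FiniteDimensional ℂ W),
      ‖p - opAt W.starProjection 1 ∘L p‖ < 1 := by
  obtain ⟨k, hk, -, hkp⟩ := hp
  have hkp' : HasSum (fun γ => opAt (k γ) γ) p := hkp
  obtain ⟨s, hs⟩ := (Metric.tendsto_nhds.1 hkp' (1 / 2) (by norm_num)).exists
  rw [dist_eq_norm, norm_sub_rev] at hs
  obtain ⟨W, hW, hWk⟩ := exists_starProjection_approx s hk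
    (ε := 1 / (2 * (s.card + 1))) (by positivity)
  refine ⟨W, hW, ?_⟩
  set q : H →L[ℂ] H := 1 - W.starProjection with hq
  have e1 : p - opAt W.starProjection 1 ∘L p = opAt q 1 ∘L p := by
    have e : opAt (Γ := Γ) q 1 = 1 - opAt W.starProjection 1 := by
      rw [← opAt_id_one]
      exact map_sub (opAtL H H (1 : Γ)) 1 W.starProjection
    rw [e, ContinuousLinearMap.sub_comp]
    rfl
  have h1 : ‖opAt (Γ := Γ) q 1‖ ≤ 1 :=
    (norm_opAt_le q 1).trans isStarProjection_starProjection.one_sub.norm_le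
  have e2 : opAt q 1 ∘L p = opAt q 1 ∘L (p - ∑ γ ∈ s, opAt (k γ) γ) +
      ∑ γ ∈ s, opAt (q ∘L k γ) γ := by
    have e3 : ∑ γ ∈ s, opAt (q ∘L k γ) γ = opAt q 1 ∘L ∑ γ ∈ s, opAt (k γ) γ := by
      rw [ContinuousLinearMap.comp_finsetSum]
      simp [opAt_comp]
    rw [e3, ContinuousLinearMap.comp_sub, sub_add_cancel]
  rw [e1, e2]
  have h2 : ‖opAt q 1 ∘L (p - ∑ γ ∈ s, opAt (k γ) γ)‖ < 1 / 2 :=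
    (ContinuousLinearMap.opNorm_comp_le _ _).trans_lt
      ((mul_le_of_le_one_left (norm_nonneg _) h1).trans_lt hs)
  have h3 : ‖∑ γ ∈ s, opAt (q ∘L k γ) γ‖ ≤ 1 / 2 := by
    refine (norm_sum_le_of_le s fun γ hγ => (norm_opAt_le _ _).trans (hWk γ hγ)).trans ?_
    rw [Finset.sum_const, nsmul_eq_mul, mul_one_div, div_le_div_iff₀ (by positivity) two_pos]
    linarith
  exact (norm_add_le _ _).trans_lt (by linarith)

end Approximation

/-! ### Frames of the module of a projection -/

section ProjectionFrames

open EllTwo PreHilbertModule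

variable {Γ : Type*} [Group Γ] {S : GeneratingSet Γ}
  {H : Type*} [NormedAddCommGroup H] [InnerProductSpace ℂ H]

theorem isRapid_of_mem_HinfCompact {p : EllTwo Γ H →L[ℂ] EllTwo Γ H}
    (hp : p ∈ HinfCompact S H) : IsRapid S p := by
  obtain ⟨k, -, hk, hkp⟩ := hp
  exact ⟨k, hk, hkp⟩

theorem HinfVec_le_stdModule (hS : S.PolynomialGrowth) : HinfVec S hS H ≤ stdModule Γ H := by
  rintro x ⟨h, -, hx⟩
  refine isClosed_stdModule.mem_of_tendsto hx (Filter.Eventually.of_forall fun s => ?_)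
  exact sum_mem fun γ _ => tensorLeft_mem_stdModule _ (shift_mem_reducedCStar γ)

theorem tensorLeft_eq_opAt (h : H) :
    tensorLeft Γ h = opAt (ContinuousLinearMap.toSpanSingleton ℂ h) (1 : Γ) := by
  simp [tensorLeft, opAt, shift_one]

theorem reducedCStar_le_topologicalClosure_Hinf (hS : S.PolynomialGrowth) :
    reducedCStar Γ ≤ (Hinf S hS).topologicalClosure := by
  refine StarSubalgebra.topologicalClosure_mono (StarAlgebra.adjoin_le ?_)
  rintro _ ⟨γ, rfl⟩
  refine (mem_Hinf_iff S _).2 ?_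
  have e : shift ℂ γ = opAt (ContinuousLinearMap.toSpanSingleton ℂ (1 : ℂ)) γ := by
    rw [opAt_scalar, one_smul]
  exact (congrArg (IsRapid S) e).mpr (isRapid_opAt S _ γ)

/-- `H^∞(Γ, H)` is dense in `H ⊗ C*_r(Γ)`. -/
theorem stdModule_le_topologicalClosure_HinfVec [CompleteSpace H] (hS : S.PolynomialGrowth) :
    stdModule Γ H ≤ (HinfVec S hS H).topologicalClosure := fun x hx => by
  refine stdModule_induction (q := (· ∈ (HinfVec S hS H).topologicalClosure)) _
    (Submodule.isClosed_topologicalClosure _) (fun _ => Iff.rfl) (fun h a ha => ?_) hx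
  refine map_mem_closure (f := fun a => tensorLeft Γ h ∘L a) (by fun_prop)
    (reducedCStar_le_topologicalClosure_Hinf hS ha) fun a ha => ?_
  refine (mem_HinfVec_iff S _).2 (IsRapid.comp hS ?_ ((mem_Hinf_iff S a).1 ha))
  rw [tensorLeft_eq_opAt]
  exact isRapid_opAt S _ 1

theorem mem_rangeOn_iff {p : EllTwo Γ H →L[ℂ] EllTwo Γ H} (hp : p ∈ HinfCompact S H)
    (hpp : IsIdempotentElem p) {x : EllTwo Γ ℂ →L[ℂ] EllTwo Γ H} :
    x ∈ rangeOn p ↔ x ∈ stdModule Γ H ∧ p ∘L x = x := by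
  refine ⟨fun hx => ⟨rangeOn_le hp hx, ?_⟩, fun hx => ⟨x, hx.1, hx.2⟩⟩
  obtain ⟨y, -, rfl⟩ := hx
  exact congrArg (· ∘L y) hpp.eq

theorem isClosed_rangeOn {p : EllTwo Γ H →L[ℂ] EllTwo Γ H} (hp : p ∈ HinfCompact S H)
    (hpp : IsIdempotentElem p) :
    IsClosed (rangeOn p : Set (EllTwo Γ ℂ →L[ℂ] EllTwo Γ H)) := by
  have e : (rangeOn p : Set (EllTwo Γ ℂ →L[ℂ] EllTwo Γ H)) =
      {x | x ∈ stdModule Γ H} ∩ {x | p ∘L x = x} := by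
    ext x
    exact mem_rangeOn_iff hp hpp
  rw [e]
  exact isClosed_stdModule.inter (isClosed_eq (by fun_prop) continuous_id)

variable [CompleteSpace H] {p : EllTwo Γ H →L[ℂ] EllTwo Γ H}

theorem mem_rangeOn_inf_HinfVec (hS : S.PolynomialGrowth) (hp : p ∈ HinfCompact S H)
    (hpp : IsIdempotentElem p) {x : EllTwo Γ ℂ →L[ℂ] EllTwo Γ H} (hx : IsRapid S x)
    (hpx : p ∘L x = x) : x ∈ rangeOn p ⊓ HinfVec S hS H := by
  have hx' : x ∈ HinfVec S hS H := (mem_HinfVec_iff S x).2 hx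
  exact ⟨(mem_rangeOn_iff hp hpp).2 ⟨HinfVec_le_stdModule hS hx', hpx⟩, hx'⟩

/-- `P ∩ H^∞(Γ, H)` is dense in `P`. -/
theorem rangeOn_subset_closure (hS : S.PolynomialGrowth) (hp : p ∈ HinfCompact S H)
    (hpp : IsIdempotentElem p) :
    (rangeOn p : Set (EllTwo Γ ℂ →L[ℂ] EllTwo Γ H)) ⊆
      closure (rangeOn p ⊓ HinfVec S hS H : Submodule ℂ (EllTwo Γ ℂ →L[ℂ] EllTwo Γ H)) := by
  intro x hx
  obtain ⟨hx1, hx2⟩ := (mem_rangeOn_iff hp hpp).1 hx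
  rw [← hx2]
  refine map_mem_closure (f := fun x => p ∘L x) (by fun_prop)
    (stdModule_le_topologicalClosure_HinfVec hS hx1) fun y hy => ?_
  exact mem_rangeOn_inf_HinfVec hS hp hpp
    ((isRapid_of_mem_HinfCompact hp).comp hS ((mem_HinfVec_iff S y).1 hy))
    (congrArg (· ∘L y) hpp.eq)

/-- A finite family in `P ∩ H^∞(Γ, H)` whose frame operator is close to `p` can be corrected to a
Parseval frame of `P ∩ H^∞(Γ, H)`: apply the inverse square root of its frame operator, completed
by `1 - p` to an invertible operator on the whole space. -/
theorem exists_isParsevalFrame_of_norm_lt (hS : S.PolynomialGrowth) (hp : p ∈ HinfCompact S H)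
    (hproj : IsStarProjection p) {n : ℕ} {η : Fin n → EllTwo Γ ℂ →L[ℂ] EllTwo Γ H}
    (hη : ∀ i, η i ∈ rangeOn p ⊓ HinfVec S hS H) (h : ‖p - frameOp η‖ < 1) :
    ∃ ζ : Fin n → (smoothProjModule hS p).carrier, (smoothProjModule hS p).IsParsevalFrame ζ := by
  have hpp := hproj.isIdempotentElem
  have hrp := isRapid_of_mem_HinfCompact hp
  have hηp : ∀ i, p ∘L η i = η i := fun i => ((mem_rangeOn_iff hp hpp).1 (hη i).1).2
  have hηr : ∀ i, IsRapid S (η i) := fun i => (mem_HinfVec_iff S _).1 (hη i).2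
  have hT : IsRapid S (frameOp η) :=
    Finset.sum_induction _ (IsRapid S) (fun _ _ hT hU => hT.add hS hU) IsRapid.zero
      fun i _ => (hηr i).comp hS (hηr i).adjoint
  -- `1 - p` is written as `1 + (-1) • p`, for which closure under sums and multiples applies.
  set a := frameOp η + (1 + (-1 : ℂ) • p) with ha
  have ha' : a = frameOp η + (1 - p) := by rw [ha, neg_one_smul, sub_eq_add_neg]
  have har : IsRapid S a := hT.add hS ((isRapid_one S).add hS (hrp.smul hS _))
  have hsa : IsSelfAdjoint a := by
    rw [ha']
    exact (isSelfAdjoint_frameOp η).add ((IsSelfAdjoint.one _).sub hproj.isSelfAdjoint)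
  have h1 : ‖1 - a‖ < 1 := by
    have e : 1 - a = p - frameOp η := by rw [ha']; abel
    rwa [e]
  obtain ⟨b, hbr, hbsa, hbab, hbcomm⟩ := har.exists_inv_sqrt hS hsa h1
  have hap : a * p = frameOp η := by
    rw [ha', add_mul, frameOp_mul_of_fixed hproj.isSelfAdjoint hηp, sub_mul, one_mul, hpp.eq,
      sub_self, add_zero]
  have hpa : p * a = frameOp η := by
    rw [ha', mul_add, mul_frameOp_of_fixed hηp, mul_sub, mul_one, hpp.eq, sub_self, add_zero]
  have hbp : b * p = p * b := hbcomm p (hap.trans hpa.symm)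
  have hζ : ∀ i, b ∘L η i ∈ rangeOn p ⊓ HinfVec S hS H := fun i => by
    refine mem_rangeOn_inf_HinfVec hS hp hpp (hbr.comp hS (hηr i)) ?_
    calc p ∘L (b ∘L η i) = (p * b) ∘L η i := rfl
      _ = b ∘L (p ∘L η i) := by rw [← hbp]; rfl
      _ = b ∘L η i := by rw [hηp]
  refine ⟨fun i => (⟨b ∘L η i, hζ i⟩ : ↥(rangeOn p ⊓ HinfVec S hS H)), ?_⟩
  refine isParsevalFrame_ofOperators_iff.2 fun x hx => ?_
  have e : frameOp (fun i => b ∘L η i) = p := by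
    rw [frameOp_comp_left, hbsa.star_eq, ← hap, mul_assoc, mul_assoc, ← hbp, ← mul_assoc,
      ← mul_assoc, hbab, one_mul]
  exact (congrArg (· ∘L x) e).trans ((mem_rangeOn_iff hp hpp).1 hx.1).2

/-- The frame operator of a Parseval frame of `P` is `p`, as an operator on `H ⊗ ℓ²(Γ)`. -/
theorem frameOp_eq_of_isParsevalFrame (hp : p ∈ HinfCompact S H) (hproj : IsStarProjection p)
    {n : ℕ} {ξ : Fin n → rangeOn p} (hξ : (projModule hp).IsParsevalFrame ξ) :
    frameOp (fun i => (ξ i : EllTwo Γ ℂ →L[ℂ] EllTwo Γ H)) = p := by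
  have hpp := hproj.isIdempotentElem
  have h1 := frameOp_mul_of_fixed hproj.isSelfAdjoint
    fun i => ((mem_rangeOn_iff hp hpp).1 (ξ i).2).2
  refine clm_ext fun g e => ?_
  have h2 : pointMass H g e = (tensorLeft Γ e ∘L shift ℂ g) (pointMass ℂ 1 1) := by
    classical
    ext x
    simp [tensorLeft, pointMass_apply, inv_mul_eq_one, eq_comm]
  have h3 := isParsevalFrame_ofOperators_iff.1 hξ (p ∘L (tensorLeft Γ e ∘L shift ℂ g))
    ⟨_, tensorLeft_mem_stdModule e (shift_mem_reducedCStar g), rfl⟩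
  rw [h2, ← h1]
  exact DFunLike.congr_fun h3 (pointMass ℂ 1 1)

theorem exists_isParsevalFrame_smooth_of_projModule (hS : S.PolynomialGrowth)
    (hp : p ∈ HinfCompact S H) (hproj : IsStarProjection p) {n : ℕ}
    (h : ∃ ξ : Fin n → (projModule hp).carrier, (projModule hp).IsParsevalFrame ξ) :
    ∃ ζ : Fin n → (smoothProjModule hS p).carrier,
      (smoothProjModule hS p).IsParsevalFrame ζ := by
  obtain ⟨ξ, hξ⟩ := h
  let ξ' : Fin n → EllTwo Γ ℂ →L[ℂ] EllTwo Γ H := fun i => (show rangeOn p from ξ i).1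
  have hξp : frameOp ξ' = p := frameOp_eq_of_isParsevalFrame hp hproj hξ
  have hcl : ξ' ∈ closure (Set.univ.pi fun _ : Fin n =>
      ((rangeOn p ⊓ HinfVec S hS H : Submodule ℂ (EllTwo Γ ℂ →L[ℂ] EllTwo Γ H)) :
        Set (EllTwo Γ ℂ →L[ℂ] EllTwo Γ H))) := by
    rw [closure_pi_set]
    exact fun i _ => rangeOn_subset_closure hS hp hproj.isIdempotentElem
      (show rangeOn p from ξ i).2
  have hopen : IsOpen {η : Fin n → EllTwo Γ ℂ →L[ℂ] EllTwo Γ H | ‖p - frameOp η‖ < 1} :=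
    isOpen_lt (continuous_const.sub continuous_frameOp).norm continuous_const
  obtain ⟨η, hη1, hη2⟩ := mem_closure_iff.1 hcl _ hopen (by simp [hξp])
  exact exists_isParsevalFrame_of_norm_lt hS hp hproj (fun i => hη2 i (Set.mem_univ i)) hη1

theorem exists_isParsevalFrame_projModule_of_smooth (hS : S.PolynomialGrowth)
    (hp : p ∈ HinfCompact S H) (hproj : IsStarProjection p) {n : ℕ}
    (h : ∃ ζ : Fin n → (smoothProjModule hS p).carrier,
      (smoothProjModule hS p).IsParsevalFrame ζ) :
    ∃ ξ : Fin n → (projModule hp).carrier, (projModule hp).IsParsevalFrame ξ := by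
  obtain ⟨ζ, hζ⟩ := h
  let ζ' : Fin n → ↥(rangeOn p ⊓ HinfVec S hS H) := ζ
  have h1 := (isParsevalFrame_ofOperators_iff (ξ := ζ')).1 hζ
  refine ⟨fun i => (⟨(ζ' i).1, (ζ' i).2.1⟩ : rangeOn p),
    isParsevalFrame_ofOperators_iff.2 fun x hx => ?_⟩
  have hcl : IsClosed {x : EllTwo Γ ℂ →L[ℂ] EllTwo Γ H | frameOp (fun i => (ζ' i).1) ∘L x = x} :=
    isClosed_eq (by fun_prop) continuous_id
  exact closure_minimal (fun x hx => h1 x hx) hcl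
    (rangeOn_subset_closure hS hp hproj.isIdempotentElem hx)

/-- `P ∩ H^∞(Γ, H)` has a finite Parseval frame: for an orthonormal basis `h` of a suitable
finite-dimensional subspace, the family `p (hᵢ ⊗ 1)` has a frame operator close to `p`. -/
theorem exists_isParsevalFrame_smooth (hS : S.PolynomialGrowth) (hp : p ∈ HinfCompact S H)
    (hproj : IsStarProjection p) :
    ∃ (n : ℕ) (ζ : Fin n → (smoothProjModule hS p).carrier),
      (smoothProjModule hS p).IsParsevalFrame ζ := by
  obtain ⟨W, hW, hWp⟩ := exists_ampl_approx hp
  let h := stdOrthonormalBasis ℂ W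
  have hpp := hproj.isIdempotentElem
  let η : Fin (Module.finrank ℂ W) → EllTwo Γ ℂ →L[ℂ] EllTwo Γ H :=
    fun i => p ∘L tensorLeft Γ (h i : H)
  have hη : ∀ i, η i ∈ rangeOn p ⊓ HinfVec S hS H := fun i => by
    refine mem_rangeOn_inf_HinfVec hS hp hpp ((isRapid_of_mem_HinfCompact hp).comp hS ?_)
      (congrArg (· ∘L tensorLeft Γ (h i : H)) hpp.eq)
    rw [tensorLeft_eq_opAt]
    exact isRapid_opAt S _ 1
  have hE : frameOp (fun i => tensorLeft Γ (h i : H)) = opAt W.starProjection 1 := by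
    rw [h.starProjection_eq_sum_rankOne, ← opAtL_apply, map_sum]
    refine Finset.sum_congr rfl fun i _ => ?_
    dsimp only
    rw [tensorLeft_eq_opAt, adjoint_opAt, opAt_comp, opAtL_apply, inv_one, mul_one,
      InnerProductSpace.rankOne_def', ContinuousLinearMap.adjoint_toSpanSingleton]
  refine ⟨_, exists_isParsevalFrame_of_norm_lt hS hp hproj hη ?_⟩
  have e : p - frameOp η = p * (p - opAt W.starProjection 1 ∘L p) := by
    rw [frameOp_comp_left, hE, hproj.isSelfAdjoint.star_eq, mul_sub, hpp.eq, mul_assoc]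
    rfl
  rw [e]
  exact (norm_mul_le _ _).trans_lt
    ((mul_le_of_le_one_left (norm_nonneg _) hproj.norm_le).trans_lt hWp)

end ProjectionFrames

theorem mainTheorem5 {Γ : Type u} [Group Γ] (S : GeneratingSet Γ) (hS : S.PolynomialGrowth)
    {H : Type v} [NormedAddCommGroup H] [InnerProductSpace ℂ H] [CompleteSpace H]
    [TopologicalSpace.SeparableSpace H]
    (p : EllTwo Γ H →L[ℂ] EllTwo Γ H) (hp : p ∈ HinfCompact S H) (hproj : IsStarProjection p) :
    ((projModule hp).IsHilbert ∧
      Module.Finite (↥(reducedCStar Γ))ᵐᵒᵖ (projModule hp).carrier ∧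
      Module.Projective (↥(reducedCStar Γ))ᵐᵒᵖ (projModule hp).carrier ∧
      ∃ (n : ℕ) (Q : PreHilbertModule.{u, u} (reducedCStar Γ)), Q.IsHilbert ∧
        ((projModule hp).directSum Q).Isomorphic (PreHilbertModule.free (reducedCStar Γ) n)) ∧
    ∀ n : ℕ,
      (∃ Q : PreHilbertModule.{u, u} (reducedCStar Γ), Q.IsHilbert ∧
        ((projModule hp).directSum Q).Isomorphic (PreHilbertModule.free (reducedCStar Γ) n)) ↔
      (∃ Q' : PreHilbertModule.{u, u} (Hinf S hS),
        ((smoothProjModule hS p).directSum Q').Isomorphic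
          (PreHilbertModule.free (Hinf S hS) n)) := by
  have hframe : ∀ n : ℕ,
      (∃ Q : PreHilbertModule.{u, u} (reducedCStar Γ), Q.IsHilbert ∧
        ((projModule hp).directSum Q).Isomorphic (PreHilbertModule.free (reducedCStar Γ) n)) ↔
      ∃ ξ : Fin n → (projModule hp).carrier, (projModule hp).IsParsevalFrame ξ := fun n =>
    ⟨fun ⟨_, _, hQ⟩ => PreHilbertModule.exists_isParsevalFrame hQ,
      fun ⟨_, hξ⟩ => ⟨_, PreHilbertModule.isHilbert_frameComplement isClosed_reducedCStar hξ,
        hξ.directSum_frameComplement⟩⟩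
  obtain ⟨m, hm⟩ := exists_isParsevalFrame_smooth hS hp hproj
  have hm' := exists_isParsevalFrame_projModule_of_smooth hS hp hproj hm
  obtain ⟨ξ, hξ⟩ := hm'
  refine ⟨⟨PreHilbertModule.isHilbert_ofOperators (isClosed_rangeOn hp hproj.isIdempotentElem),
    hξ.finite, hξ.projective, m, (hframe m).2 ⟨ξ, hξ⟩⟩, fun n => (hframe n).trans ⟨fun h => ?_,
    fun ⟨_, hQ⟩ => exists_isParsevalFrame_projModule_of_smooth hS hp hproj
      (PreHilbertModule.exists_isParsevalFrame hQ)⟩⟩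
  obtain ⟨ζ, hζ⟩ := exists_isParsevalFrame_smooth_of_projModule hS hp hproj h
  exact ⟨_, hζ.directSum_frameComplement⟩
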